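/- Let $\mathcal K$ be a tt-category, that is, an essentially small, idempotent-complete triangulated category with a symmetric monoidal structure $(\otimes,\mathbb 1)$ whose tensor product is exact in each variable. A *tt-ring* in a symmetric monoidal additive category is a commutative ring object $(A,\mu,\eta)$ that is *separable*, i.e. $\mu:A\otimes A\to A$ has a section which is a morphism of $A,A$-bimodules. For a tt-ring $A$ in $\mathcal K$, let $A\text{-}\mathrm{Mod}_{\mathcal K}$ be the category of $A$-modules in $\mathcal K$ with the symmetric monoidal structure given by the relative tensor product $\otimes_A$ (a direct summand of $\otimes$) and unit $\mathbb 1_A=A$, and let $F_A=A\otimes-:\mathcal K\to A\text{-}\mathrm{Mod}_{\mathcal K}$ be the extension-of-scalars tensor functor. A commutative $A$-algebra $A\to B$ in $\mathcal K$ is also regarded as a commutative ring object of $A\text{-}\mathrm{Mod}_{\mathcal K}$. The product $R\times S$ of ring objects is $R\oplus S$ with componentwise structure. A *splitting tower* of a tt-ring $A$ is a sequence of tt-rings and ring morphisms $A^{[0]}\to A^{[1]}\to A^{[2]}\to\cdots$ with $A^{[0]}=\mathbb 1$, $A^{[1]}=A$, and such that for every $n\ge 1$ there is an isomorphism of $A^{[n]}$-algebras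 $$h: A^{[n]}\otimes_{A^{[n-1]}}A^{[n]}\ \xrightarrow{\ \sim\ }\ A^{[n]}\times A^{[n+1]}$$ with $\mathrm{pr}_1\circ h=\mu$ (the source being an $A^{[n]}$-algebra via the left factor). It is unique up to isomorphism. The tt-ring $A$ has *finite degree* $d\in\mathbb N$ if $A^{[d]}\neq 0$ and $A^{[d+1]}=0$. The same definitions apply in $A\text{-}\mathrm{Mod}_{\mathcal K}$. **Theorem.** Let $A$ be a tt-ring of finite degree $d$ in a tt-category $\mathcal K$, and let $A^{[2]}$ be the second stage of a splitting tower of $A$, seen as a ring object of $A\text{-}\mathrm{Mod}_{\mathcal K}$ through $A=A^{[1]}\to A^{[2]}$. Then $A^{[2]}$ is a tt-ring in $A\text{-}\mathrm{Mod}_{\mathcal K}$ and there is a ring isomorphism in $A\text{-}\mathrm{Mod}_{\mathcal K}$ $$F_A(A)\;\simeq\;\mathbb 1_A\times A^{[2]}.$$ Moreover, if $d\ge 1$ (equivalently, $A\neq 0$), then $A^{[2]}$ has finite degree $d-1$ in $A\text{-}\mathrm{Mod}_{\mathcal K}$. -/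

import Mathlib

set_option linter.unusedSectionVars false

open CategoryTheory CategoryTheory.Limits MonoidalCategory MonObj

universe v u w

namespace TTRings

section modules

variable {C : Type u} [Category.{v} C] [MonoidalCategory C]

/-- A ring object `A` is separable if its multiplication `A ⊗ A ⟶ A` has a section `σ` which is a
morphism of `A,A`-bimodules. -/
class IsSeparable (A : C) [MonObj A] : Prop where
  exists_section : ∃ σ : A ⟶ A ⊗ A, σ ≫ μ[A] = 𝟙 A ∧
    μ[A] ≫ σ = (A ◁ σ) ≫ (α_ A A A).inv ≫ (μ[A] ▷ A) ∧
    μ[A] ≫ σ = (σ ▷ A) ≫ (α_ A A A).hom ≫ (A ◁ μ[A])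

/-- A tt-ring: a commutative separable ring object. -/
class IsTTRing [BraidedCategory C] (A : C) [MonObj A] : Prop extends
    IsCommMonObj A, IsSeparable A

variable (A : C) [MonObj A] (X Y Z W : C) [ModObj A X] [ModObj A Y] [ModObj A Z] [ModObj A W]

/-- The (left) action of `A` on an `A`-module `X`. -/
def lact : A ⊗ X ⟶ X := ModObj.smul (M := A) (X := X)

lemma one_lact : η[A] ▷ X ≫ lact A X = (λ_ X).hom := ModObj.one_smul_self A X

lemma mul_lact : μ[A] ▷ X ≫ lact A X = (α_ A A X).hom ≫ A ◁ lact A X ≫ lact A X :=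
  ModObj.mul_smul_self A X

variable [SymmetricCategory C]

/-- The right action of the commutative ring `A` on `X`: the left action after the symmetry. -/
def ract : X ⊗ A ⟶ X := (β_ X A).hom ≫ lact A X

lemma one_ract : X ◁ η[A] ≫ ract A X = (ρ_ X).hom := by
  simp [ract, one_lact]

lemma braid_ract : (β_ A X).hom ≫ ract A X = lact A X := by
  simp [ract]

variable [IsCommMonObj A]

lemma braid_aux : (β_ (A ⊗ X) A).hom = (α_ A X A).hom ≫ A ◁ (β_ X A).hom ≫ (α_ A A X).inv ≫
    (β_ A A).hom ▷ X ≫ (α_ A A X).hom := by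
  simp

lemma ract_ract : ract A X ▷ A ≫ ract A X = (α_ X A A).hom ≫ X ◁ μ[A] ≫ ract A X := by
  have h : μ[A] ▷ X = (β_ A A).hom ▷ X ≫ μ[A] ▷ X := by
    rw [← comp_whiskerRight, IsCommMonObj.mul_comm]
  have h2 : (α_ X A A).hom ≫ X ◁ μ[A] ≫ ract A X = (β_ X A).hom ▷ A ≫ (α_ A X A).hom ≫
      A ◁ (β_ X A).hom ≫ (α_ A A X).inv ≫ (β_ A A).hom ▷ X ≫ μ[A] ▷ X ≫ lact A X := by
    have := BraidedCategory.hexagon_forward X A A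
    simp only [ract, BraidedCategory.braiding_naturality_right_assoc]
    rw [← Category.assoc (_ ▷ X), ← h, ← reassoc_of% this]
    simp
  rw [h2]
  simp only [ract, comp_whiskerRight, Category.assoc, BraidedCategory.braiding_naturality_left_assoc,
    mul_lact, braid_aux]

lemma lact_ract : lact A X ▷ A ≫ ract A X = (α_ A X A).hom ≫ A ◁ ract A X ≫ lact A X := by
  have h : μ[A] ▷ X = (β_ A A).hom ▷ X ≫ μ[A] ▷ X := by
    rw [← comp_whiskerRight, IsCommMonObj.mul_comm]
  have h2 : (β_ A A).hom ▷ X ≫ (α_ A A X).hom ≫ A ◁ lact A X ≫ lact A X =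
    (α_ A A X).hom ≫ A ◁ lact A X ≫ lact A X := by
    rw [← mul_lact, ← Category.assoc, ← h]
  simp only [ract, BraidedCategory.braiding_naturality_left_assoc, braid_aux, Category.assoc, h2]
  simp

variable [IsSeparable A]

/-- A chosen bimodule section of the multiplication. -/
noncomputable def sepσ : A ⟶ A ⊗ A := (IsSeparable.exists_section (A := A)).choose

lemma sepσ_mul : sepσ A ≫ μ[A] = 𝟙 A := (IsSeparable.exists_section (A := A)).choose_spec.1

lemma mul_sepσ : μ[A] ≫ sepσ A = (A ◁ sepσ A) ≫ (α_ A A A).inv ≫ (μ[A] ▷ A) :=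
  (IsSeparable.exists_section (A := A)).choose_spec.2.1

lemma mul_sepσ' : μ[A] ≫ sepσ A = (sepσ A ▷ A) ≫ (α_ A A A).hom ≫ (A ◁ μ[A]) :=
  (IsSeparable.exists_section (A := A)).choose_spec.2.2

/-- The map `x ↦ ∑ x aᵢ ⊗ bᵢ`, where `σ(1) = ∑ aᵢ ⊗ bᵢ`. It is a section of the right action. -/
noncomputable def coact : X ⟶ X ⊗ A :=
  (ρ_ X).inv ≫ X ◁ (η[A] ≫ sepσ A) ≫ (α_ X A A).inv ≫ ract A X ▷ A

lemma coact_ract : coact A X ≫ ract A X = 𝟙 X := by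
  simp only [coact, Category.assoc, ract_ract, Iso.inv_hom_id_assoc]
  rw [← whiskerLeft_comp_assoc, Category.assoc, sepσ_mul]
  simp [one_ract]

lemma ract_coact : ract A X ≫ coact A X = X ◁ sepσ A ≫ (α_ X A A).inv ≫ ract A X ▷ A := by
  have h : (ρ_ A).inv ≫ A ◁ η[A] ≫ A ◁ sepσ A ≫ (α_ A A A).inv ≫ (μ[A] ▷ A) = sepσ A := by
    rw [← mul_sepσ]; simp
  have h' := congr(X ◁ $h ≫ (α_ X A A).inv ≫ ract A X ▷ A)
  rw [← h']
  simp only [coact, ← Category.assoc, rightUnitor_inv_naturality]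
  simp only [Category.assoc, ← whisker_exchange_assoc, whiskerLeft_comp]
  simp only [← comp_whiskerRight, ract_ract, whiskerRight_tensor_assoc,
    Iso.hom_inv_id_assoc]
  simp

lemma coact_mul : coact A X ▷ A ≫ (α_ X A A).hom ≫ X ◁ μ[A] =
    X ◁ sepσ A ≫ (α_ X A A).inv ≫ ract A X ▷ A := by
  have h : (λ_ A).inv ≫ η[A] ▷ A ≫ sepσ A ▷ A ≫ (α_ A A A).hom ≫ (A ◁ μ[A]) = sepσ A := by
    rw [← mul_sepσ']; simp
  have h' := congr(X ◁ $h ≫ (α_ X A A).inv ≫ ract A X ▷ A)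
  rw [← h']
  simp only [coact, Category.assoc, comp_whiskerRight, whiskerLeft_comp]
  have h1 : ract A X ▷ A ▷ A ≫ (α_ X A A).hom ≫ X ◁ μ[A] =
    (α_ (X ⊗ A) A A).hom ≫ (X ⊗ A) ◁ μ[A] ≫ ract A X ▷ A := by
    rw [whisker_exchange, whiskerRight_tensor]; simp
  rw [h1]
  simp

/-- A morphism `f : X ⊗ Y ⟶ T` is `A`-balanced: `f (x a ⊗ y) = f (x ⊗ a y)`. -/
def Balanced {T : C} (f : X ⊗ Y ⟶ T) : Prop :=
  ract A X ▷ Y ≫ f = (α_ X A Y).hom ≫ X ◁ lact A Y ≫ f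

/-- The endomorphism `x ⊗ y ↦ ∑ x aᵢ ⊗ bᵢ y` of `X ⊗ Y`. It is balanced, and it is the identity on
balanced maps (see `proj_balanced` and `Balanced.proj_comp`), so it is idempotent and its image is
the coequalizer `X ⊗_A Y` of `X ⊗ A ⊗ Y ⇉ X ⊗ Y`. -/
noncomputable def proj : X ⊗ Y ⟶ X ⊗ Y := coact A X ▷ Y ≫ (α_ X A Y).hom ≫ X ◁ lact A Y

lemma proj_balanced : Balanced A X Y (proj A X Y) := by
  have h1 : (α_ X A Y).hom ≫ X ◁ lact A Y ≫ coact A X ▷ Y ≫ (α_ X A Y).hom ≫ X ◁ lact A Y =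
      (coact A X ▷ A ≫ (α_ X A A).hom ≫ X ◁ μ[A]) ▷ Y ≫ (α_ X A Y).hom ≫ X ◁ lact A Y := by
    have h2 : X ◁ (μ[A] ▷ Y ≫ lact A Y) = X ◁ ((α_ A A Y).hom ≫ A ◁ lact A Y ≫ lact A Y) := by
      rw [mul_lact]
    simp only [whiskerLeft_comp] at h2
    simp [whisker_exchange_assoc, h2]
  rw [Balanced, proj, h1, coact_mul, ← comp_whiskerRight_assoc, ract_coact]

variable {A X Y} in
lemma Balanced.proj_comp {T : C} {f : X ⊗ Y ⟶ T} (hf : Balanced A X Y f) : proj A X Y ≫ f = f := by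
  simp only [proj, Category.assoc]
  rw [← hf, ← comp_whiskerRight_assoc, coact_ract]
  simp

variable [IsIdempotentComplete C]

lemma proj_split : ∃ (T : C) (i : T ⟶ X ⊗ Y) (p : X ⊗ Y ⟶ T), i ≫ p = 𝟙 T ∧ p ≫ i = proj A X Y :=
  IsIdempotentComplete.idempotents_split _ _ (proj_balanced A X Y).proj_comp

/-- The relative tensor product `X ⊗_A Y`, as the image of the idempotent `proj`. The projection
`tensπ` is the universal balanced map (`tensπ_balanced`, `Balanced.fac`). -/
noncomputable def tens : C := (proj_split A X Y).choose

/-- The inclusion of `X ⊗_A Y` into `X ⊗ Y`. -/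
noncomputable def tensι : tens A X Y ⟶ X ⊗ Y := (proj_split A X Y).choose_spec.choose

/-- The projection of `X ⊗ Y` onto `X ⊗_A Y`. -/
noncomputable def tensπ : X ⊗ Y ⟶ tens A X Y := (proj_split A X Y).choose_spec.choose_spec.choose

@[simp]
lemma tensι_π : tensι A X Y ≫ tensπ A X Y = 𝟙 _ :=
  (proj_split A X Y).choose_spec.choose_spec.choose_spec.1

@[simp]
lemma tensι_π_assoc {T : C} (k : tens A X Y ⟶ T) : tensι A X Y ≫ tensπ A X Y ≫ k = k := by
  rw [reassoc_of% tensι_π]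

lemma tensπ_ι : tensπ A X Y ≫ tensι A X Y = proj A X Y :=
  (proj_split A X Y).choose_spec.choose_spec.choose_spec.2

instance : IsSplitEpi (tensπ A X Y) := ⟨⟨⟨tensι A X Y, by simp⟩⟩⟩
instance : IsSplitMono (tensι A X Y) := ⟨⟨⟨tensπ A X Y, by simp⟩⟩⟩

instance epi_whiskerLeft {P Q : C} (W : C) (f : P ⟶ Q) [IsSplitEpi f] : IsSplitEpi (W ◁ f) :=
  ⟨⟨⟨W ◁ section_ f, by simp [← whiskerLeft_comp]⟩⟩⟩
instance epi_whiskerRight {P Q : C} (W : C) (f : P ⟶ Q) [IsSplitEpi f] : IsSplitEpi (f ▷ W) :=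
  ⟨⟨⟨section_ f ▷ W, by simp [← comp_whiskerRight]⟩⟩⟩

lemma tensπ_balanced : ract A X ▷ Y ≫ tensπ A X Y = (α_ X A Y).hom ≫ X ◁ lact A Y ≫ tensπ A X Y := by
  rw [← cancel_mono (tensι A X Y)]
  simp only [Category.assoc, tensπ_ι]
  exact proj_balanced A X Y

variable {A X Y} in
lemma Balanced.fac {T : C} {f : X ⊗ Y ⟶ T} (hf : Balanced A X Y f) :
    tensπ A X Y ≫ tensι A X Y ≫ f = f := by
  rw [reassoc_of% @tensπ_ι, hf.proj_comp]

variable {X Y} in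
lemma whiskerLeft_fac {W T : C} {f : W ⊗ (X ⊗ Y) ⟶ T}
    (hf : W ◁ (ract A X ▷ Y) ≫ f = W ◁ (α_ X A Y).hom ≫ W ◁ X ◁ lact A Y ≫ f) :
    W ◁ tensπ A X Y ≫ W ◁ tensι A X Y ≫ f = f := by
  rw [← whiskerLeft_comp_assoc, tensπ_ι]
  simp only [proj, whiskerLeft_comp, Category.assoc]
  rw [← hf, ← whiskerLeft_comp_assoc, ← comp_whiskerRight, coact_ract]
  simp

variable {X Y} in
lemma whiskerRight_fac {W T : C} {f : (X ⊗ Y) ⊗ W ⟶ T}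
    (hf : ract A X ▷ Y ▷ W ≫ f = (α_ X A Y).hom ▷ W ≫ (X ◁ lact A Y) ▷ W ≫ f) :
    tensπ A X Y ▷ W ≫ tensι A X Y ▷ W ≫ f = f := by
  rw [← comp_whiskerRight_assoc, tensπ_ι]
  simp only [proj, comp_whiskerRight, Category.assoc]
  rw [← hf, ← comp_whiskerRight_assoc, ← comp_whiskerRight, coact_ract]
  simp

/-- The action of `A` on `X ⊗_A Y`, induced by `a ⊗ x ⊗ y ↦ a x ⊗ y`. -/
noncomputable def tensAct : A ⊗ tens A X Y ⟶ tens A X Y :=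
  A ◁ tensι A X Y ≫ (α_ A X Y).inv ≫ lact A X ▷ Y ≫ tensπ A X Y

lemma tensπ_act : A ◁ tensπ A X Y ≫ tensAct A X Y = (α_ A X Y).inv ≫ lact A X ▷ Y ≫ tensπ A X Y := by
  apply whiskerLeft_fac
  have h1 : A ◁ ract A X ▷ Y ≫ (α_ A X Y).inv ≫ lact A X ▷ Y ≫ tensπ A X Y =
    (α_ A (X ⊗ A) Y).inv ≫ ((α_ A X A).inv ≫ lact A X ▷ A ≫ ract A X) ▷ Y ≫ tensπ A X Y := by
    rw [lact_ract]
    simp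
  rw [h1]
  simp only [comp_whiskerRight, Category.assoc, tensπ_balanced]
  simp only [associator_inv_naturality_right_assoc, whisker_exchange_assoc,
    associator_naturality_left_assoc, pentagon_inv_inv_hom_hom_inv_assoc]

noncomputable instance : ModObj A (tens A X Y) where
  smul := tensAct A X Y
  one_smul := by
    change η[A] ▷ _ ≫ tensAct A X Y = (λ_ _).hom
    rw [← cancel_epi (_ ◁ tensπ A X Y), whisker_exchange_assoc, tensπ_act, whiskerRight_tensor_assoc,
      Iso.hom_inv_id_assoc, ← comp_whiskerRight_assoc, one_lact]
    simp
  mul_smul := by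
    change μ[A] ▷ _ ≫ tensAct A X Y = (α_ _ _ _).hom ≫ A ◁ tensAct A X Y ≫ tensAct A X Y
    rw [← cancel_epi (_ ◁ tensπ A X Y), whisker_exchange_assoc, tensπ_act, whiskerRight_tensor_assoc,
      Iso.hom_inv_id_assoc, ← comp_whiskerRight_assoc, mul_lact]
    simp only [tensor_whiskerLeft, Category.assoc, Iso.inv_hom_id_assoc, ← whiskerLeft_comp_assoc, tensπ_act]
    simp [tensπ_act]

lemma tensπ_lact : A ◁ tensπ A X Y ≫ lact A (tens A X Y) =
    (α_ A X Y).inv ≫ lact A X ▷ Y ≫ tensπ A X Y := tensπ_act A X Y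

lemma tensπ_ract : tensπ A X Y ▷ A ≫ ract A (tens A X Y) =
    (α_ X Y A).hom ≫ X ◁ ract A Y ≫ tensπ A X Y := by
  have h := tensπ_balanced A X Y
  simp only [ract, comp_whiskerRight, Category.assoc] at h
  rw [ract, BraidedCategory.braiding_naturality_left_assoc, tensπ_lact,
    BraidedCategory.braiding_tensor_left_hom]
  simp [h, ract]

section hom
variable {A X Y Z W}
variable {X' Y' Z' : C} [ModObj A X'] [ModObj A Y'] [ModObj A Z']
  (f : X ⟶ X') [IsModHom A f] (g : Y ⟶ Y') [IsModHom A g] (h : Z ⟶ Z') [IsModHom A h]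

lemma lact_hom : lact A X ≫ f = A ◁ f ≫ lact A X' := IsModHom.smul_hom (A := A) (f := f)

lemma ract_hom : ract A X ≫ f = f ▷ A ≫ ract A X' := by
  simp [ract, lact_hom]

variable (A) in
lemma isModHom_mk (f : X ⟶ X') (hf : lact A X ≫ f = A ◁ f ≫ lact A X') : IsModHom A f := ⟨hf⟩

variable (A) in
/-- The morphism `f ⊗_A g`. -/
noncomputable def tensHom : tens A X Y ⟶ tens A X' Y' := tensι A X Y ≫ (f ⊗ₘ g) ≫ tensπ A X' Y'

lemma tensπ_hom : tensπ A X Y ≫ tensHom A f g = (f ⊗ₘ g) ≫ tensπ A X' Y' := by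
  apply Balanced.fac
  rw [Balanced]
  simp only [MonoidalCategory.tensorHom_def, Category.assoc, ← comp_whiskerRight_assoc, ract_hom]
  simp only [comp_whiskerRight, Category.assoc, whisker_exchange_assoc]
  rw [← whisker_exchange_assoc, tensπ_balanced, ← whiskerLeft_comp_assoc, lact_hom]
  simp

instance : IsModHom A (tensHom A f g) := isModHom_mk _ _ <| by
  rw [← cancel_epi (A ◁ tensπ A X Y), reassoc_of% @tensπ_lact, tensπ_hom, ← whiskerLeft_comp_assoc,
    tensπ_hom, whiskerLeft_comp_assoc, tensπ_lact]
  simp only [MonoidalCategory.tensorHom_def, whiskerLeft_comp, Category.assoc,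
    ← comp_whiskerRight_assoc, lact_hom]
  simp only [associator_inv_naturality_right_assoc, whisker_exchange_assoc, comp_whiskerRight,
    Category.assoc, associator_inv_naturality_middle_assoc]
end hom

lemma assocHom_aux : tensπ A X Y ▷ Z ≫ tensι A X Y ▷ Z ≫
    (α_ X Y Z).hom ≫ X ◁ tensπ A Y Z ≫ tensπ A X (tens A Y Z) =
    (α_ X Y Z).hom ≫ X ◁ tensπ A Y Z ≫ tensπ A X (tens A Y Z) := by
  apply whiskerRight_fac
  rw [associator_naturality_left_assoc, ← whisker_exchange_assoc, tensπ_balanced,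
    associator_naturality_middle_assoc]
  simp only [tensor_whiskerLeft, Category.assoc, Iso.inv_hom_id_assoc]
  rw [← whiskerLeft_comp_assoc, tensπ_lact]
  simp

/-- The associator of `⊗_A`, induced by that of `⊗`. -/
noncomputable def assocHom : tens A (tens A X Y) Z ⟶ tens A X (tens A Y Z) :=
  tensι A (tens A X Y) Z ≫ tensι A X Y ▷ Z ≫
    (α_ X Y Z).hom ≫ X ◁ tensπ A Y Z ≫ tensπ A X (tens A Y Z)

lemma tensπ_assocHom : tensπ A X Y ▷ Z ≫ tensπ A (tens A X Y) Z ≫ assocHom A X Y Z =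
    (α_ X Y Z).hom ≫ X ◁ tensπ A Y Z ≫ tensπ A X (tens A Y Z) := by
  refine Eq.trans ?_ (assocHom_aux A X Y Z)
  congr 1
  apply Balanced.fac
  rw [Balanced, ← cancel_epi (tensπ A X Y ▷ A ▷ Z), ← comp_whiskerRight_assoc, tensπ_ract,
    associator_naturality_left_assoc, ← whisker_exchange_assoc, comp_whiskerRight_assoc,
    comp_whiskerRight_assoc, assocHom_aux, associator_naturality_middle_assoc,
    ← whiskerLeft_comp_assoc, tensπ_balanced]
  simp

lemma assocInv_aux : X ◁ tensπ A Y Z ≫ X ◁ tensι A Y Z ≫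
    (α_ X Y Z).inv ≫ tensπ A X Y ▷ Z ≫ tensπ A (tens A X Y) Z =
    (α_ X Y Z).inv ≫ tensπ A X Y ▷ Z ≫ tensπ A (tens A X Y) Z := by
  apply whiskerLeft_fac
  rw [associator_inv_naturality_right_assoc, whisker_exchange_assoc,
    associator_inv_naturality_middle_assoc]
  have h := tensπ_balanced A (tens A X Y) Z
  rw [← cancel_epi ((α_ _ _ _).inv), Iso.inv_hom_id_assoc] at h
  rw [← h, whiskerRight_tensor_assoc, Iso.hom_inv_id_assoc, ← comp_whiskerRight_assoc (tensπ A X Y ▷ A), tensπ_ract]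
  simp

/-- The inverse of the associator of `⊗_A`. -/
noncomputable def assocInv : tens A X (tens A Y Z) ⟶ tens A (tens A X Y) Z :=
  tensι A X (tens A Y Z) ≫ X ◁ tensι A Y Z ≫
    (α_ X Y Z).inv ≫ tensπ A X Y ▷ Z ≫ tensπ A (tens A X Y) Z

lemma tensπ_assocInv : X ◁ tensπ A Y Z ≫ tensπ A X (tens A Y Z) ≫ assocInv A X Y Z =
    (α_ X Y Z).inv ≫ tensπ A X Y ▷ Z ≫ tensπ A (tens A X Y) Z := by
  refine Eq.trans ?_ (assocInv_aux A X Y Z)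
  congr 1
  apply Balanced.fac
  rw [Balanced, ← cancel_epi ((X ⊗ A) ◁ tensπ A Y Z), whisker_exchange_assoc, assocInv_aux,
    associator_naturality_right_assoc, ← whiskerLeft_comp_assoc, tensπ_lact, whiskerLeft_comp_assoc,
    whiskerLeft_comp_assoc, assocInv_aux, associator_inv_naturality_middle_assoc,
    ← comp_whiskerRight_assoc (X ◁ _)]
  have h := tensπ_balanced A X Y
  rw [← cancel_epi ((α_ _ _ _).inv), Iso.inv_hom_id_assoc] at h
  rw [← h]
  simp

/-- The associator of `⊗_A` as an isomorphism. -/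
noncomputable def assocIso : tens A (tens A X Y) Z ≅ tens A X (tens A Y Z) where
  hom := assocHom A X Y Z
  inv := assocInv A X Y Z
  hom_inv_id := by
    rw [← cancel_epi (tensπ A (tens A X Y) Z), ← cancel_epi (tensπ A X Y ▷ Z),
      reassoc_of% @tensπ_assocHom, tensπ_assocInv]
    simp
  inv_hom_id := by
    rw [← cancel_epi (tensπ A X (tens A Y Z)), ← cancel_epi (X ◁ tensπ A Y Z),
      reassoc_of% @tensπ_assocInv, tensπ_assocHom]
    simp

instance : IsModHom A (assocIso A X Y Z).hom := isModHom_mk _ _ <| by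
  change lact _ _ ≫ assocHom _ _ _ _ = A ◁ assocHom _ _ _ _ ≫ _
  rw [← cancel_epi (A ◁ tensπ A (tens A X Y) Z), ← cancel_epi (A ◁ tensπ A X Y ▷ Z),
    reassoc_of% @tensπ_lact, associator_inv_naturality_middle_assoc, ← comp_whiskerRight_assoc,
    tensπ_lact]
  simp only [← whiskerLeft_comp_assoc, tensπ_assocHom, comp_whiskerRight_assoc]
  simp only [whiskerLeft_comp_assoc, tensπ_lact, associator_inv_naturality_right_assoc,
    whisker_exchange_assoc]
  simp

lemma tensπ_braid : tensπ A X Y ≫ tensι A X Y ≫ (β_ X Y).hom ≫ tensπ A Y X =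
    (β_ X Y).hom ≫ tensπ A Y X := by
  apply Balanced.fac
  rw [Balanced, BraidedCategory.braiding_naturality_right_assoc,
    BraidedCategory.braiding_naturality_left_assoc, ← braid_ract, comp_whiskerRight_assoc,
    tensπ_balanced, ract, whiskerLeft_comp_assoc, ← BraidedCategory.braiding_naturality_left_assoc,
    BraidedCategory.braiding_tensor_left_hom, BraidedCategory.braiding_tensor_right_hom]
  simp

/-- The symmetry `X ⊗_A Y ≅ Y ⊗_A X`, induced by that of `⊗`. -/
noncomputable def braidIso : tens A X Y ≅ tens A Y X where
  hom := tensι A X Y ≫ (β_ X Y).hom ≫ tensπ A Y X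
  inv := tensι A Y X ≫ (β_ Y X).hom ≫ tensπ A X Y
  hom_inv_id := by
    rw [← cancel_epi (tensπ A X Y)]
    simp [tensπ_braid]
  inv_hom_id := by
    rw [← cancel_epi (tensπ A Y X)]
    simp [tensπ_braid]

lemma tensπ_braidIso : tensπ A X Y ≫ (braidIso A X Y).hom = (β_ X Y).hom ≫ tensπ A Y X :=
  tensπ_braid A X Y

instance : IsModHom A (braidIso A X Y).hom := isModHom_mk _ _ <| by
  rw [← cancel_epi (A ◁ tensπ A X Y), reassoc_of% @tensπ_lact, tensπ_braidIso, ← whiskerLeft_comp_assoc,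
    tensπ_braidIso, whiskerLeft_comp_assoc, tensπ_lact, BraidedCategory.braiding_naturality_left_assoc]
  rw [← braid_ract A Y, comp_whiskerRight_assoc, tensπ_balanced,
    BraidedCategory.braiding_tensor_left_hom]
  simp

attribute [local instance] ModObj.regular

lemma lact_regular : lact A A = μ[A] := rfl
lemma ract_regular : ract A A = μ[A] := by simp [ract, lact_regular]

lemma tensπ_lu : tensπ A A X ≫ tensι A A X ≫ lact A X = lact A X := by
  apply Balanced.fac
  rw [Balanced, ract_regular, mul_lact]

/-- The left unitor `A ⊗_A X ≅ X`, induced by the action. -/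
noncomputable def luIso : tens A A X ≅ X where
  hom := tensι A A X ≫ lact A X
  inv := (λ_ X).inv ≫ η[A] ▷ X ≫ tensπ A A X
  hom_inv_id := by
    rw [← cancel_epi (tensπ A A X), Category.assoc, reassoc_of% @tensπ_lu, leftUnitor_inv_naturality_assoc,
      whisker_exchange_assoc]
    have h := tensπ_balanced A A X
    rw [← cancel_epi ((α_ _ _ _).inv), Iso.inv_hom_id_assoc, ract_regular] at h
    rw [← h, whiskerRight_tensor_assoc, Iso.hom_inv_id_assoc, ← comp_whiskerRight_assoc,
      MonObj.one_mul]
    simp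
  inv_hom_id := by
    simp [tensπ_lu, one_lact]

lemma tensπ_luIso : tensπ A A X ≫ (luIso A X).hom = lact A X := tensπ_lu A X

instance : IsModHom A (luIso A X).hom := isModHom_mk _ _ <| by
  rw [← cancel_epi (A ◁ tensπ A A X), reassoc_of% @tensπ_lact, tensπ_luIso, ← whiskerLeft_comp_assoc,
    tensπ_luIso, lact_regular, mul_lact]
  simp

/-- The right unitor `X ⊗_A A ≅ X`. -/
noncomputable def ruIso : tens A X A ≅ X := braidIso A X A ≪≫ luIso A X

instance : IsModHom A (ruIso A X).hom :=
  inferInstanceAs (IsModHom A ((braidIso A X A).hom ≫ (luIso A X).hom))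

lemma tensπ_ruIso : tensπ A X A ≫ (ruIso A X).hom = ract A X := by
  simp [ruIso, reassoc_of% @tensπ_braidIso, tensπ_luIso, ract]

attribute [local instance] ModObj.regular

variable {A} in
/-- An `A`-linear isomorphism of the underlying objects is an isomorphism of `A`-modules. -/
@[simps]
def modIso {M N : Mod C A} (e : M.X ≅ N.X) [IsModHom A e.hom] : M ≅ N where
  hom := { hom := e.hom }
  inv := { hom := e.inv }

/-- The tensor product `⊗_A` on the category `Mod C A` of `A`-modules, with unit `A`. -/
noncomputable instance modStruct : MonoidalCategoryStruct (Mod C A) where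
  tensorObj M N := { X := tens A M.X N.X }
  whiskerLeft M _ _ f := { hom := tensHom A (𝟙 M.X) f.hom }
  whiskerRight f N := { hom := tensHom A f.hom (𝟙 N.X) }
  tensorHom f g := { hom := tensHom A f.hom g.hom }
  tensorUnit := { X := A, mod := ModObj.regular A }
  associator M N P := modIso (assocIso A M.X N.X P.X)
  leftUnitor M := modIso (M := { X := tens A A M.X }) (luIso A M.X)
  rightUnitor M := modIso (M := { X := tens A M.X A }) (ruIso A M.X)

section
variable {A} (M N P Q : Mod C A)

/-- The projection `M ⊗ N ⟶ M ⊗_A N`. -/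
noncomputable def pr : M.X ⊗ N.X ⟶ (M ⊗ N).X := tensπ A M.X N.X

instance : IsSplitEpi (pr M N) := inferInstanceAs (IsSplitEpi (tensπ A M.X N.X))

variable {M N P Q}

@[simp]
lemma pr_whiskerLeft (f : N ⟶ P) : pr M N ≫ (M ◁ f).hom = M.X ◁ f.hom ≫ pr M P := by
  have := tensπ_hom (A := A) (𝟙 M.X) f.hom
  rwa [id_tensorHom] at this

@[simp]
lemma pr_whiskerLeft_assoc (f : N ⟶ P) {T : C} (k : (M ⊗ P).X ⟶ T) :
    pr M N ≫ (M ◁ f).hom ≫ k = M.X ◁ f.hom ≫ pr M P ≫ k := by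
  rw [reassoc_of% pr_whiskerLeft]

@[simp]
lemma pr_whiskerRight (f : M ⟶ N) : pr M P ≫ (f ▷ P).hom = f.hom ▷ P.X ≫ pr N P := by
  have := tensπ_hom (A := A) f.hom (𝟙 P.X)
  rwa [tensorHom_id] at this

@[simp]
lemma pr_whiskerRight_assoc (f : M ⟶ N) {T : C} (k : (N ⊗ P).X ⟶ T) :
    pr M P ≫ (f ▷ P).hom ≫ k = f.hom ▷ P.X ≫ pr N P ≫ k := by
  rw [reassoc_of% pr_whiskerRight]

@[simp]
lemma pr_tensorHom (f : M ⟶ N) (g : P ⟶ Q) : pr M P ≫ (f ⊗ₘ g).hom = (f.hom ⊗ₘ g.hom) ≫ pr N Q :=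
  tensπ_hom (A := A) f.hom g.hom

@[simp]
lemma pr_tensorHom_assoc (f : M ⟶ N) (g : P ⟶ Q) {T : C} (k : (N ⊗ Q).X ⟶ T) :
    pr M P ≫ (f ⊗ₘ g).hom ≫ k = (f.hom ⊗ₘ g.hom) ≫ pr N Q ≫ k := by
  rw [reassoc_of% pr_tensorHom]

variable (M N P Q)

@[simp]
lemma pr_associator_hom : pr M N ▷ P.X ≫ pr (M ⊗ N) P ≫ (α_ M N P).hom.hom =
    (α_ M.X N.X P.X).hom ≫ M.X ◁ pr N P ≫ pr M (N ⊗ P) :=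
  tensπ_assocHom A M.X N.X P.X

@[simp]
lemma pr_associator_hom_assoc {T : C} (k : (M ⊗ (N ⊗ P)).X ⟶ T) :
    pr M N ▷ P.X ≫ pr (M ⊗ N) P ≫ (α_ M N P).hom.hom ≫ k =
      (α_ M.X N.X P.X).hom ≫ M.X ◁ pr N P ≫ pr M (N ⊗ P) ≫ k := by
  rw [reassoc_of% pr_associator_hom]

@[simp]
lemma pr_leftUnitor_hom : pr (𝟙_ (Mod C A)) M ≫ (λ_ M).hom.hom = lact A M.X :=
  tensπ_luIso A M.X

@[simp]
lemma pr_leftUnitor_hom_assoc {T : C} (k : M.X ⟶ T) :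
    pr (𝟙_ (Mod C A)) M ≫ (λ_ M).hom.hom ≫ k = lact A M.X ≫ k := by
  rw [reassoc_of% pr_leftUnitor_hom]

@[simp]
lemma pr_rightUnitor_hom : pr M (𝟙_ (Mod C A)) ≫ (ρ_ M).hom.hom = ract A M.X :=
  tensπ_ruIso A M.X

@[simp]
lemma pr_rightUnitor_hom_assoc {T : C} (k : M.X ⟶ T) :
    pr M (𝟙_ (Mod C A)) ≫ (ρ_ M).hom.hom ≫ k = ract A M.X ≫ k := by
  rw [reassoc_of% pr_rightUnitor_hom]

lemma pr_balanced : ract A M.X ▷ N.X ≫ pr M N = (α_ M.X A N.X).hom ≫ M.X ◁ lact A N.X ≫ pr M N :=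
  tensπ_balanced A M.X N.X

variable {M N P Q}

lemma tensor_ext {f g : M ⊗ N ⟶ P} (h : pr M N ≫ f.hom = pr M N ≫ g.hom) : f = g := by
  ext; exact (cancel_epi _).1 h

lemma tensor_ext₃ {f g : (M ⊗ N) ⊗ P ⟶ Q} (h : pr M N ▷ P.X ≫ pr (M ⊗ N) P ≫ f.hom =
    pr M N ▷ P.X ≫ pr (M ⊗ N) P ≫ g.hom) : f = g :=
  tensor_ext ((cancel_epi (pr M N ▷ P.X)).1 h)

lemma tensor_ext₃' {f g : M ⊗ (N ⊗ P) ⟶ Q} (h : M.X ◁ pr N P ≫ pr M (N ⊗ P) ≫ f.hom =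
    M.X ◁ pr N P ≫ pr M (N ⊗ P) ≫ g.hom) : f = g :=
  tensor_ext ((cancel_epi (M.X ◁ pr N P)).1 h)

lemma tensor_ext₄ {R : Mod C A} {f g : ((M ⊗ N) ⊗ P) ⊗ Q ⟶ R}
    (h : pr M N ▷ P.X ▷ Q.X ≫ pr (M ⊗ N) P ▷ Q.X ≫ pr ((M ⊗ N) ⊗ P) Q ≫ f.hom =
      pr M N ▷ P.X ▷ Q.X ≫ pr (M ⊗ N) P ▷ Q.X ≫ pr ((M ⊗ N) ⊗ P) Q ≫ g.hom) : f = g :=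
  tensor_ext₃ ((cancel_epi (pr M N ▷ P.X ▷ Q.X)).1 h)
end

/-- The monoidal category of `A`-modules. -/
noncomputable instance : MonoidalCategory (Mod C A) where
  tensorHom_def f g := by
    apply tensor_ext
    simp [MonoidalCategory.tensorHom_def]
  id_tensorHom_id M N := by
    apply tensor_ext
    simp
  tensorHom_comp_tensorHom f g h k := by
    apply tensor_ext
    simp
  whiskerLeft_id M N := by
    apply tensor_ext
    simp
  id_whiskerRight M N := by
    apply tensor_ext
    simp
  associator_naturality f g h := by
    apply tensor_ext₃
    simp [MonoidalCategory.tensorHom_def, ← comp_whiskerRight_assoc]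
    rw [← whisker_exchange_assoc, pr_associator_hom, whisker_exchange_assoc,
      ← whiskerLeft_comp_assoc, pr_tensorHom]
    simp [MonoidalCategory.tensorHom_def]
  leftUnitor_naturality f := by
    apply tensor_ext
    simp
    exact (lact_hom f.hom).symm
  rightUnitor_naturality f := by
    apply tensor_ext
    simp
    exact (ract_hom f.hom).symm
  pentagon M N P Q := by
    apply tensor_ext₄
    simp
    have h1 := congr($(pr_associator_hom M N P) ▷ Q.X)
    simp only [comp_whiskerRight] at h1
    rw [reassoc_of% h1, associator_naturality_left_assoc, ← whisker_exchange_assoc,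
      pr_associator_hom, pr_associator_hom_assoc, associator_naturality_middle_assoc,
      pr_whiskerLeft, ← whiskerLeft_comp_assoc, ← whiskerLeft_comp_assoc,
      Category.assoc, pr_associator_hom]
    simp
  triangle M N := by
    apply tensor_ext₃
    simp
    rw [← comp_whiskerRight_assoc, pr_rightUnitor_hom, ← whiskerLeft_comp_assoc,
      pr_leftUnitor_hom]
    exact (pr_balanced M N).symm

section
variable {A} (M N P : Mod C A)

/-- The symmetry of `A`-modules. -/
noncomputable def braidMod : M ⊗ N ≅ N ⊗ M := modIso (braidIso A M.X N.X)

@[simp]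
lemma pr_braidMod : pr M N ≫ (braidMod M N).hom.hom = (β_ M.X N.X).hom ≫ pr N M :=
  tensπ_braidIso A M.X N.X

@[simp]
lemma pr_braidMod_assoc {T : C} (k : (N ⊗ M).X ⟶ T) :
    pr M N ≫ (braidMod M N).hom.hom ≫ k = (β_ M.X N.X).hom ≫ pr N M ≫ k := by
  rw [reassoc_of% pr_braidMod]

@[simp]
lemma pr_associator_inv : M.X ◁ pr N P ≫ pr M (N ⊗ P) ≫ (α_ M N P).inv.hom =
    (α_ M.X N.X P.X).inv ≫ pr M N ▷ P.X ≫ pr (M ⊗ N) P :=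
  tensπ_assocInv A M.X N.X P.X

@[simp]
lemma pr_associator_inv_assoc {T : C} (k : ((M ⊗ N) ⊗ P).X ⟶ T) :
    M.X ◁ pr N P ≫ pr M (N ⊗ P) ≫ (α_ M N P).inv.hom ≫ k =
      (α_ M.X N.X P.X).inv ≫ pr M N ▷ P.X ≫ pr (M ⊗ N) P ≫ k := by
  rw [reassoc_of% pr_associator_inv]

noncomputable instance : BraidedCategory (Mod C A) where
  braiding := braidMod
  braiding_naturality_right M _ _ f := by
    apply tensor_ext
    simp
  braiding_naturality_left f N := by
    apply tensor_ext
    simp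
  hexagon_forward M N P := by
    apply tensor_ext₃
    simp only [Mod.comp_hom', pr_associator_hom_assoc, pr_braidMod_assoc,
      BraidedCategory.braiding_naturality_right_assoc, pr_whiskerRight_assoc]
    rw [← comp_whiskerRight_assoc, pr_braidMod, comp_whiskerRight_assoc, pr_associator_hom,
      pr_associator_hom_assoc, pr_whiskerLeft, ← whiskerLeft_comp_assoc, pr_braidMod]
    simp
  hexagon_reverse M N P := by
    apply tensor_ext₃'
    simp only [Mod.comp_hom', pr_associator_inv_assoc, pr_braidMod_assoc,
      BraidedCategory.braiding_naturality_left_assoc, pr_whiskerLeft_assoc]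
    rw [← whiskerLeft_comp_assoc, pr_braidMod, whiskerLeft_comp_assoc, pr_associator_inv,
      pr_associator_inv_assoc, pr_whiskerRight, ← comp_whiskerRight_assoc, pr_braidMod]
    simp

@[simp]
lemma pr_braiding : pr M N ≫ (β_ M N).hom.hom = (β_ M.X N.X).hom ≫ pr N M :=
  tensπ_braidIso A M.X N.X

@[simp]
lemma pr_braiding_assoc {T : C} (k : (N ⊗ M).X ⟶ T) :
    pr M N ≫ (β_ M N).hom.hom ≫ k = (β_ M.X N.X).hom ≫ pr N M ≫ k := by
  rw [reassoc_of% pr_braiding]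

/-- The monoidal category of `A`-modules is symmetric. -/
noncomputable instance : SymmetricCategory (Mod C A) where
  symmetry M N := by
    apply tensor_ext
    simp
end


section ext

/-- The free `A`-module `A ⊗ x`. -/
@[reducible]
def freeModObj (x : C) : ModObj A (A ⊗ x) where
  smul := (α_ A A x).inv ≫ μ[A] ▷ x
  one_smul := by
    change η[A] ▷ (A ⊗ x) ≫ (α_ A A x).inv ≫ μ[A] ▷ x = (λ_ (A ⊗ x)).hom
    rw [whiskerRight_tensor_assoc, Iso.hom_inv_id_assoc, ← comp_whiskerRight, MonObj.one_mul]
    simp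
  mul_smul := by
    change μ[A] ▷ (A ⊗ x) ≫ (α_ A A x).inv ≫ μ[A] ▷ x = (α_ A A (A ⊗ x)).hom ≫
      A ◁ ((α_ A A x).inv ≫ μ[A] ▷ x) ≫ (α_ A A x).inv ≫ μ[A] ▷ x
    rw [whiskerRight_tensor_assoc, Iso.hom_inv_id_assoc, ← comp_whiskerRight, MonObj.mul_assoc]
    simp

attribute [local instance] freeModObj ModObj.regular

lemma lact_free (x : C) : lact A (A ⊗ x) = (α_ A A x).inv ≫ μ[A] ▷ x := rfl

lemma ract_free (x : C) : ract A (A ⊗ x) =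
    (α_ A x A).hom ≫ A ◁ (β_ x A).hom ≫ (α_ A A x).inv ≫ μ[A] ▷ x := by
  have h : μ[A] ▷ x = (β_ A A).hom ▷ x ≫ μ[A] ▷ x := by
    rw [← comp_whiskerRight, IsCommMonObj.mul_comm]
  rw [ract, lact_free, BraidedCategory.braiding_tensor_left_hom]
  conv_rhs => rw [h]
  simp

/-- The map `a ⊗ x ⊗ b ⊗ y ↦ a b ⊗ x ⊗ y`. -/
noncomputable def extMulAux (x y : C) : (A ⊗ x) ⊗ (A ⊗ y) ⟶ A ⊗ (x ⊗ y) :=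
  tensorμ A x A y ≫ μ[A] ▷ (x ⊗ y)

lemma extMulAux_balanced (x y : C) :
    Balanced A (A ⊗ x) (A ⊗ y) (extMulAux A x y) := by
  have h1 : (μ[A] ▷ x) ▷ (A ⊗ y) ≫ tensorμ A x A y =
      tensorμ (A ⊗ A) x A y ≫ μ[A] ▷ A ▷ (x ⊗ y) := by
    simpa using tensorμ_natural_left (μ[A]) (𝟙 x) A y
  have h2 : (A ⊗ x) ◁ (μ[A] ▷ y) ≫ tensorμ A x A y =
      tensorμ A x (A ⊗ A) y ≫ (A ◁ μ[A]) ▷ (x ⊗ y) := by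
    simpa using tensorμ_natural_right A x (μ[A]) (𝟙 y)
  have h3 : (μ[A] ▷ A) ▷ (x ⊗ y) ≫ μ[A] ▷ (x ⊗ y) = (α_ A A A).hom ▷ (x ⊗ y) ≫
      (A ◁ μ[A]) ▷ (x ⊗ y) ≫ μ[A] ▷ (x ⊗ y) := by
    simp only [← comp_whiskerRight, MonObj.mul_assoc]
  rw [Balanced, ract_free, lact_free, extMulAux]
  simp only [comp_whiskerRight, whiskerLeft_comp, Category.assoc]
  rw [reassoc_of% h1, reassoc_of% h2, h3]
  simp only [← Category.assoc]
  congr 2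
  simp only [tensorμ, BraidedCategory.braiding_tensor_right_hom]
  monoidal

/-- The canonical map `(A ⊗ x) ⊗_A (A ⊗ y) ⟶ A ⊗ (x ⊗ y)`. -/
noncomputable def extMul (x y : C) : tens A (A ⊗ x) (A ⊗ y) ⟶ A ⊗ (x ⊗ y) :=
  tensι A (A ⊗ x) (A ⊗ y) ≫ extMulAux A x y

lemma tensπ_extMul (x y : C) : tensπ A (A ⊗ x) (A ⊗ y) ≫ extMul A x y =
    tensorμ A x A y ≫ μ[A] ▷ (x ⊗ y) :=
  (extMulAux_balanced A x y).fac

lemma extMul_isModHom (x y : C) : IsModHom A (extMul A x y) := isModHom_mk _ _ <| by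
  rw [← cancel_epi (A ◁ tensπ A (A ⊗ x) (A ⊗ y)), reassoc_of% @tensπ_lact, tensπ_extMul,
    ← whiskerLeft_comp_assoc, tensπ_extMul, lact_free, lact_free]
  have h1 : (μ[A] ▷ x) ▷ (A ⊗ y) ≫ tensorμ A x A y =
      tensorμ (A ⊗ A) x A y ≫ μ[A] ▷ A ▷ (x ⊗ y) := by
    simpa using tensorμ_natural_left (μ[A]) (𝟙 x) A y
  have h3 : (μ[A] ▷ A) ▷ (x ⊗ y) ≫ μ[A] ▷ (x ⊗ y) = (α_ A A A).hom ▷ (x ⊗ y) ≫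
      (A ◁ μ[A]) ▷ (x ⊗ y) ≫ μ[A] ▷ (x ⊗ y) := by
    simp only [← comp_whiskerRight, MonObj.mul_assoc]
  simp only [comp_whiskerRight, whiskerLeft_comp, Category.assoc]
  rw [reassoc_of% h1, h3, associator_inv_naturality_middle_assoc]
  simp only [← Category.assoc]
  congr 2
  simp only [tensorμ]
  monoidal

lemma map_isModHom {x y : C} (f : x ⟶ y) : IsModHom A (A ◁ f) := isModHom_mk _ _ <| by
  simp only [lact_free, Category.assoc, ← whisker_exchange]
  simp

lemma unit_isModHom : IsModHom A (ρ_ A).inv := isModHom_mk _ _ <| by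
  simp [lact_free, lact_regular]

attribute [local instance] extMul_isModHom map_isModHom unit_isModHom

lemma extMul_natural_left {x x' : C} (f : x ⟶ x') (y : C) :
    tensHom A (A ◁ f) (𝟙 (A ⊗ y)) ≫ extMul A x' y = extMul A x y ≫ A ◁ (f ▷ y) := by
  have h := tensorμ_natural_left (𝟙 A) f A y
  simp only [id_tensorHom, id_whiskerRight] at h
  rw [← cancel_epi (tensπ A _ _), reassoc_of% @tensπ_hom, reassoc_of% @tensπ_extMul, tensπ_extMul, tensorHom_id,
    reassoc_of% h, whisker_exchange]

lemma extMul_natural_right (x : C) {y y' : C} (f : y ⟶ y') :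
    tensHom A (𝟙 (A ⊗ x)) (A ◁ f) ≫ extMul A x y' = extMul A x y ≫ A ◁ (x ◁ f) := by
  have h := tensorμ_natural_right A x (𝟙 A) f
  simp only [id_tensorHom, whiskerLeft_id] at h
  rw [← cancel_epi (tensπ A _ _), reassoc_of% @tensπ_hom, reassoc_of% @tensπ_extMul, tensπ_extMul, id_tensorHom,
    reassoc_of% h, whisker_exchange]

lemma extMul_assoc (x y z : C) :
    tensHom A (extMul A x y) (𝟙 (A ⊗ z)) ≫ extMul A (x ⊗ y) z ≫ A ◁ (α_ x y z).hom =
      (assocIso A (A ⊗ x) (A ⊗ y) (A ⊗ z)).hom ≫ tensHom A (𝟙 (A ⊗ x)) (extMul A y z) ≫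
        extMul A x (y ⊗ z) := by
  have h1 : (μ[A] ▷ (x ⊗ y)) ▷ (A ⊗ z) ≫ tensorμ A (x ⊗ y) A z =
      tensorμ (A ⊗ A) (x ⊗ y) A z ≫ μ[A] ▷ A ▷ ((x ⊗ y) ⊗ z) := by
    simpa using tensorμ_natural_left (μ[A]) (𝟙 (x ⊗ y)) A z
  have h2 : (A ⊗ x) ◁ (μ[A] ▷ (y ⊗ z)) ≫ tensorμ A x A (y ⊗ z) =
      tensorμ A x (A ⊗ A) (y ⊗ z) ≫ (A ◁ μ[A]) ▷ (x ⊗ y ⊗ z) := by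
    simpa using tensorμ_natural_right A x (μ[A]) (𝟙 (y ⊗ z))
  have h3 : (μ[A] ▷ A) ▷ ((x ⊗ y) ⊗ z) ≫ μ[A] ▷ ((x ⊗ y) ⊗ z) = (α_ A A A).hom ▷ ((x ⊗ y) ⊗ z) ≫
      (A ◁ μ[A]) ▷ ((x ⊗ y) ⊗ z) ≫ μ[A] ▷ ((x ⊗ y) ⊗ z) := by
    simp only [← comp_whiskerRight, MonObj.mul_assoc]
  have h4 := tensor_associativity A x A y A z
  change _ = assocHom _ _ _ _ ≫ _
  rw [← cancel_epi (tensπ A _ _), reassoc_of% @tensπ_hom, reassoc_of% @tensπ_extMul,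
    ← cancel_epi (tensπ A _ _ ▷ _), reassoc_of% @tensπ_assocHom, reassoc_of% @tensπ_hom, tensπ_extMul, tensorHom_id, id_tensorHom,
    ← comp_whiskerRight_assoc, tensπ_extMul, ← whiskerLeft_comp_assoc, tensπ_extMul]
  simp only [comp_whiskerRight, whiskerLeft_comp, Category.assoc]
  rw [reassoc_of% h1, reassoc_of% h2, ← reassoc_of% h4, MonoidalCategory.tensorHom_def, Category.assoc,
    whisker_exchange_assoc, reassoc_of% h3, ← whisker_exchange]

lemma extMul_unit_left (x : C) :
    (luIso A (A ⊗ x)).hom = tensHom A (ρ_ A).inv (𝟙 (A ⊗ x)) ≫ extMul A (𝟙_ C) x ≫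
      A ◁ (λ_ x).hom := by
  rw [← cancel_epi (tensπ A _ _), reassoc_of% @tensπ_hom, reassoc_of% @tensπ_extMul, tensπ_luIso,
    lact_free, ← whisker_exchange]
  simp only [← Category.assoc]
  congr 1
  simp only [tensorμ, braiding_tensorUnit_left]
  monoidal

lemma extMul_unit_right (x : C) :
    (ruIso A (A ⊗ x)).hom = tensHom A (𝟙 (A ⊗ x)) (ρ_ A).inv ≫ extMul A x (𝟙_ C) ≫
      A ◁ (ρ_ x).hom := by
  rw [← cancel_epi (tensπ A _ _), reassoc_of% @tensπ_hom, reassoc_of% @tensπ_extMul, tensπ_ruIso,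
    ract_free, ← whisker_exchange]
  simp only [← Category.assoc]
  congr 1
  simp only [tensorμ]
  monoidal

/-- The extension of scalars functor `F_A = A ⊗ -` from `C` to `A`-modules. -/
def extFunctor : C ⥤ Mod C A where
  obj x := { X := A ⊗ x }
  map f := { hom := A ◁ f, isModHom := map_isModHom A f }

/-- The canonical monoidal structure of `F_A`, with `(A ⊗ x) ⊗_A (A ⊗ y) ⟶ A ⊗ (x ⊗ y)`. Through it
`F_A` sends ring objects to ring objects. -/
noncomputable instance : (extFunctor A).LaxMonoidal := Functor.LaxMonoidal.mk
  { hom := (ρ_ A).inv, isModHom := unit_isModHom A }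
  (fun x y => { hom := extMul A x y, isModHom := extMul_isModHom A x y})
  (fun f y => Mod.hom_ext _ _ (extMul_natural_left A f y))
  (fun x f => Mod.hom_ext _ _ (extMul_natural_right A x f))
  (fun x y z => Mod.hom_ext _ _ (extMul_assoc A x y z))
  (fun x => Mod.hom_ext _ _ (extMul_unit_left A x))
  (fun x => Mod.hom_ext _ _ (extMul_unit_right A x))

end ext

section algebra

variable {A} {B : C} [MonObj B] [IsCommMonObj B] (f : A ⟶ B) [IsMonHom f]

section
variable [ModObj A B] {f}

lemma ract_alg (h : lact A B = f ▷ B ≫ μ[B]) : ract A B = B ◁ f ≫ μ[B] := by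
  rw [ract, h, ← BraidedCategory.braiding_naturality_right_assoc, IsCommMonObj.mul_comm]

lemma alg_balanced (h : lact A B = f ▷ B ≫ μ[B]) : Balanced A B B μ[B] := by
  simp [Balanced, ract_alg h, h]

lemma tensπ_algMul (h : lact A B = f ▷ B ≫ μ[B]) :
    tensπ A B B ≫ tensι A B B ≫ μ[B] = μ[B] :=
  (alg_balanced h).fac

lemma algMul_isModHom (h : lact A B = f ▷ B ≫ μ[B]) :
    IsModHom A (tensι A B B ≫ μ[B]) := by
  apply isModHom_mk
  rw [← cancel_epi (A ◁ tensπ A B B), reassoc_of% @tensπ_lact, tensπ_algMul h,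
    ← whiskerLeft_comp_assoc, tensπ_algMul h, h]
  simp [whisker_exchange_assoc]

end

/-- An `A`-algebra `f : A ⟶ B` seen as an `A`-module. -/
def algMod : Mod C A where
  X := B
  mod := letI := ModObj.regular B; Mod.scalarRestriction f B

/-- The multiplication of `B` on the object underlying `algMod f`. -/
@[reducible]
def algModMon : MonObj (algMod f).X := ‹MonObj B›

attribute [local instance] algModMon

lemma algModComm : IsCommMonObj (algMod f).X := inferInstanceAs (IsCommMonObj B)

lemma algModHom : IsMonHom (show A ⟶ (algMod f).X from f) := inferInstanceAs (IsMonHom f)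

attribute [local instance] algModComm algModHom

lemma lact_algMod : lact A (algMod f).X = f ▷ B ≫ μ[B] := rfl

/-- The unit `A ⟶ B` of the `A`-algebra `B`. -/
noncomputable def algOne : 𝟙_ (Mod C A) ⟶ algMod f where
  hom := f
  isModHom := ⟨by
    change μ[A] ≫ f = A ◁ f ≫ f ▷ B ≫ μ[B]
    rw [IsMonHom.mul_hom, tensorHom_def'_assoc]⟩

/-- The multiplication `B ⊗_A B ⟶ B` induced by that of `B`. -/
noncomputable def algMul : algMod f ⊗ algMod f ⟶ algMod f where
  hom := tensι A (algMod f).X (algMod f).X ≫ μ[B]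
  isModHom := algMul_isModHom (lact_algMod f)

@[simp]
lemma pr_algMul : pr (algMod f) (algMod f) ≫ (algMul f).hom = μ[(algMod f).X] := tensπ_algMul (lact_algMod f)

/-- A commutative `A`-algebra `f : A ⟶ B` in `C`, seen as a ring object of the monoidal category of
`A`-modules. -/
noncomputable def algRing : Mon (Mod C A) where
  X := algMod f
  mon :=
    { one := algOne f
      mul := algMul f
      one_mul := by
        apply tensor_ext
        simp
        rfl
      mul_one := by
        apply tensor_ext
        simp
        exact (ract_alg (lact_algMod f)).symm
      mul_assoc := by
        apply tensor_ext₃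
        simp only [Mod.comp_hom', pr_whiskerRight_assoc, pr_associator_hom_assoc, pr_whiskerLeft_assoc,
          pr_algMul]
        rw [← comp_whiskerRight_assoc, ← whiskerLeft_comp_assoc, pr_algMul]
        exact MonObj.mul_assoc (algMod f).X }

end algebra

section preadd
variable [Preadditive C] [MonoidalPreadditive C] {A}

instance (M N : Mod C A) : Zero (M ⟶ N) := ⟨{ hom := 0, isModHom := isModHom_mk _ _ (by simp) }⟩

instance (M N : Mod C A) : Add (M ⟶ N) := ⟨fun f g =>
  { hom := f.hom + g.hom, isModHom := isModHom_mk _ _ (by simp [lact_hom]) }⟩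

instance (M N : Mod C A) : Neg (M ⟶ N) := ⟨fun f =>
  { hom := - f.hom, isModHom := isModHom_mk _ _ (by
      rw [show A ◁ (-f.hom) = -(A ◁ f.hom) from (tensorLeft A).map_neg]; simp [lact_hom]) }⟩

instance (M N : Mod C A) : Sub (M ⟶ N) := ⟨fun f g =>
  { hom := f.hom - g.hom, isModHom := isModHom_mk _ _ (by
      rw [show A ◁ (f.hom - g.hom) = A ◁ f.hom - A ◁ g.hom from (tensorLeft A).map_sub]
      simp [lact_hom]) }⟩

instance instNSMul (M N : Mod C A) : SMul ℕ (M ⟶ N) := ⟨fun n f =>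
  { hom := n • f.hom, isModHom := isModHom_mk _ _ (by
      rw [show A ◁ (n • f.hom) = n • A ◁ f.hom from (tensorLeft A).map_nsmul]
      simp [lact_hom]) }⟩

instance instZSMul (M N : Mod C A) : SMul ℤ (M ⟶ N) := ⟨fun n f =>
  { hom := n • f.hom, isModHom := isModHom_mk _ _ (by
      rw [show A ◁ (n • f.hom) = n • A ◁ f.hom from (tensorLeft A).map_zsmul]
      simp [lact_hom]) }⟩

instance (M N : Mod C A) : AddCommGroup (M ⟶ N) :=
  Function.Injective.addCommGroup (fun f : M ⟶ N => f.hom) (fun _ _ h => Mod.hom_ext _ _ h)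
    rfl (fun _ _ => rfl) (fun _ => rfl) (fun _ _ => rfl) (fun _ _ => rfl) (fun _ _ => rfl)

variable {M N P : Mod C A}

@[simp] lemma zero_hom : (0 : M ⟶ N).hom = 0 := rfl
@[simp] lemma add_hom (f g : M ⟶ N) : (f + g).hom = f.hom + g.hom := rfl

instance : Preadditive (Mod C A) where
  add_comp _ _ _ _ _ _ := by ext; simp
  comp_add _ _ _ _ _ _ := by ext; simp

instance : MonoidalPreadditive (Mod C A) where
  whiskerLeft_zero := by intros; apply tensor_ext; simp
  zero_whiskerRight := by intros; apply tensor_ext; simp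
  whiskerLeft_add f g := by apply tensor_ext; simp
  add_whiskerRight f g := by apply tensor_ext; simp

variable [HasBinaryBiproducts C]

variable (M N) in
/-- The direct sum of two modules. -/
@[reducible]
noncomputable def biprodModObj : ModObj A (M.X ⊞ N.X) where
  smul := biprod.lift (A ◁ biprod.fst ≫ lact A M.X) (A ◁ biprod.snd ≫ lact A N.X)
  one_smul := by
    change η[A] ▷ (M.X ⊞ N.X) ≫ _ = (λ_ _).hom
    ext
    · rw [Category.assoc, biprod.lift_fst, ← whisker_exchange_assoc, one_lact]
      simp
    · rw [Category.assoc, biprod.lift_snd, ← whisker_exchange_assoc, one_lact]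
      simp
  mul_smul := by
    change μ[A] ▷ (M.X ⊞ N.X) ≫ _ = (α_ A A _).hom ≫ A ◁ _ ≫ _
    ext
    · simp only [Category.assoc, biprod.lift_fst, ← whisker_exchange_assoc, mul_lact]
      rw [← whiskerLeft_comp_assoc, biprod.lift_fst]
      simp
    · simp only [Category.assoc, biprod.lift_snd, ← whisker_exchange_assoc, mul_lact]
      rw [← whiskerLeft_comp_assoc, biprod.lift_snd]
      simp

section
attribute [local instance] biprodModObj

variable (M N)

lemma lact_biprod : lact A (M.X ⊞ N.X) =
    biprod.lift (A ◁ biprod.fst ≫ lact A M.X) (A ◁ biprod.snd ≫ lact A N.X) := rfl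

lemma fst_isModHom : IsModHom A (biprod.fst : M.X ⊞ N.X ⟶ M.X) :=
  isModHom_mk _ _ (by simp [lact_biprod])

lemma snd_isModHom : IsModHom A (biprod.snd : M.X ⊞ N.X ⟶ N.X) :=
  isModHom_mk _ _ (by simp [lact_biprod])

lemma inl_isModHom : IsModHom A (biprod.inl : M.X ⟶ M.X ⊞ N.X) :=
  isModHom_mk _ _ (by
    apply biprod.hom_ext <;> simp [lact_biprod, ← whiskerLeft_comp_assoc])

lemma inr_isModHom : IsModHom A (biprod.inr : N.X ⟶ M.X ⊞ N.X) :=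
  isModHom_mk _ _ (by
    apply biprod.hom_ext <;> simp [lact_biprod, ← whiskerLeft_comp_assoc])

end

instance : HasBinaryBiproducts (Mod C A) where
  has_binary_biproduct M N := hasBinaryBiproduct_of_total
    { pt := { X := M.X ⊞ N.X, mod := biprodModObj M N }
      fst := { hom := biprod.fst, isModHom := fst_isModHom M N }
      snd := { hom := biprod.snd, isModHom := snd_isModHom M N }
      inl := { hom := biprod.inl, isModHom := inl_isModHom M N }
      inr := { hom := biprod.inr, isModHom := inr_isModHom M N }
      inl_fst := Mod.hom_ext _ _ biprod.inl_fst
      inl_snd := Mod.hom_ext _ _ biprod.inl_snd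
      inr_fst := Mod.hom_ext _ _ biprod.inr_fst
      inr_snd := Mod.hom_ext _ _ biprod.inr_snd } (Mod.hom_ext _ _ biprod.total)

end preadd

end modules

section tower

variable {C : Type u} [Category.{v} C] [MonoidalCategory C] [Preadditive C]
  [HasBinaryBiproducts C]

/-- The product `R × S` of two ring objects: the object `R ⊕ S` with componentwise unit and
multiplication. -/
noncomputable def prodRing (R S : Mon C) : Mon C where
  X := R.X ⊞ S.X
  mon :=
    { one := biprod.lift η[R.X] η[S.X]
      mul := biprod.lift ((biprod.fst ⊗ₘ biprod.fst) ≫ μ[R.X])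
        ((biprod.snd ⊗ₘ biprod.snd) ≫ μ[S.X])
      one_mul := by
        apply biprod.hom_ext
        · rw [Category.assoc, biprod.lift_fst, ← tensorHom_id, tensorHom_comp_tensorHom_assoc,
            biprod.lift_fst, Category.id_comp, tensorHom_def', Category.assoc, MonObj.one_mul,
            leftUnitor_naturality]
        · rw [Category.assoc, biprod.lift_snd, ← tensorHom_id, tensorHom_comp_tensorHom_assoc,
            biprod.lift_snd, Category.id_comp, tensorHom_def', Category.assoc, MonObj.one_mul,
            leftUnitor_naturality]
      mul_one := by
        apply biprod.hom_ext
        · rw [Category.assoc, biprod.lift_fst, ← id_tensorHom, tensorHom_comp_tensorHom_assoc,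
            biprod.lift_fst, Category.id_comp, MonoidalCategory.tensorHom_def, Category.assoc,
            MonObj.mul_one, rightUnitor_naturality]
        · rw [Category.assoc, biprod.lift_snd, ← id_tensorHom, tensorHom_comp_tensorHom_assoc,
            biprod.lift_snd, Category.id_comp, MonoidalCategory.tensorHom_def, Category.assoc,
            MonObj.mul_one, rightUnitor_naturality]
      mul_assoc := by
        apply biprod.hom_ext
        · simp only [Category.assoc, biprod.lift_fst]
          rw [← tensorHom_id, ← id_tensorHom, tensorHom_comp_tensorHom_assoc,
            tensorHom_comp_tensorHom_assoc, biprod.lift_fst, Category.id_comp,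
            show ((biprod.fst : R.X ⊞ S.X ⟶ R.X) ⊗ₘ (biprod.fst ⊗ₘ biprod.fst) ≫ μ[R.X]) =
              (biprod.fst ⊗ₘ (biprod.fst ⊗ₘ biprod.fst)) ≫ (R.X ◁ μ[R.X]) by
                rw [← id_tensorHom, tensorHom_comp_tensorHom, Category.comp_id],
            show ((((biprod.fst : R.X ⊞ S.X ⟶ R.X) ⊗ₘ biprod.fst) ≫ μ[R.X]) ⊗ₘ biprod.fst) =
              ((biprod.fst ⊗ₘ biprod.fst) ⊗ₘ biprod.fst) ≫ (μ[R.X] ▷ R.X) by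
                rw [← tensorHom_id, tensorHom_comp_tensorHom, Category.comp_id]]
          simp only [Category.assoc, MonObj.mul_assoc, associator_naturality_assoc]
        · simp only [Category.assoc, biprod.lift_snd]
          rw [← tensorHom_id, ← id_tensorHom, tensorHom_comp_tensorHom_assoc,
            tensorHom_comp_tensorHom_assoc, biprod.lift_snd, Category.id_comp,
            show ((biprod.snd : R.X ⊞ S.X ⟶ S.X) ⊗ₘ (biprod.snd ⊗ₘ biprod.snd) ≫ μ[S.X]) =
              (biprod.snd ⊗ₘ (biprod.snd ⊗ₘ biprod.snd)) ≫ (S.X ◁ μ[S.X]) by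
                rw [← id_tensorHom, tensorHom_comp_tensorHom, Category.comp_id],
            show ((((biprod.snd : R.X ⊞ S.X ⟶ S.X) ⊗ₘ biprod.snd) ≫ μ[S.X]) ⊗ₘ biprod.snd) =
              ((biprod.snd ⊗ₘ biprod.snd) ⊗ₘ biprod.snd) ≫ (μ[S.X] ▷ S.X) by
                rw [← tensorHom_id, tensorHom_comp_tensorHom, Category.comp_id]]
          simp only [Category.assoc, MonObj.mul_assoc, associator_naturality_assoc] }

variable [SymmetricCategory C]

/-- For a morphism of ring objects `f : R ⟶ B`, the morphism of ring objects `q : B ⊗ B ⟶ P`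
exhibits `P` as `B ⊗_R B`: it is a coequalizer of the two actions
`b ⊗ r ⊗ b' ↦ b f(r) ⊗ b'` and `b ⊗ r ⊗ b' ↦ b ⊗ f(r) b'`. -/
def IsRelativeTensor {R B P : Mon C} (f : R ⟶ B) (q : B ⊗ B ⟶ P) : Prop :=
  ∃ w : ((B.X ◁ f.hom ≫ μ[B.X]) ▷ B.X) ≫ q.hom =
      ((α_ B.X R.X B.X).hom ≫ B.X ◁ (f.hom ▷ B.X ≫ μ[B.X])) ≫ q.hom,
    Nonempty (IsColimit (Cofork.ofπ q.hom w))

/-- A splitting tower of the ring object `A`: tt-rings `ring 0 ⟶ ring 1 ⟶ ring 2 ⟶ ⋯` with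
`ring 0 ≅ 𝟙`, `ring 1 ≅ A`, and for every `n` a ring isomorphism
`h : ring (n+1) ⊗_{ring n} ring (n+1) ≅ ring (n+1) × ring (n+2)` such that `pr₁ ∘ h` is induced
by the multiplication and `h` is a morphism of `ring (n+1)`-algebras. Here `ring (n+1)` acts on
the source via the left factor, `b ↦ b ⊗ 1`, and on `ring (n+2)` via `map (n+1)`. -/
structure SplittingTower (A : Mon C) where
  ring : ℕ → Mon C
  isTTRing (n : ℕ) : IsTTRing (ring n).X
  map (n : ℕ) : ring n ⟶ ring (n + 1)
  ringZero : ring 0 ≅ Mon.trivial C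
  ringOne : ring 1 ≅ A
  step (n : ℕ) : ∃ (P : Mon C) (q : ring (n + 1) ⊗ ring (n + 1) ⟶ P)
    (h : P ≅ prodRing (ring (n + 1)) (ring (n + 2))),
    IsRelativeTensor (map n) q ∧
    q.hom ≫ h.hom.hom ≫ biprod.fst = μ[(ring (n + 1)).X] ∧
    (ρ_ (ring (n + 1)).X).inv ≫ ((ring (n + 1)).X ◁ η[(ring (n + 1)).X]) ≫
      q.hom ≫ h.hom.hom ≫ biprod.snd = (map (n + 1)).hom

/-- `A` has finite degree `d`: in its splitting tower (which is unique up to isomorphism) the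
ring in position `d` is nonzero and the ring in position `d + 1` is zero. -/
def HasDegree (A : Mon C) (d : ℕ) : Prop :=
  ∃ T : SplittingTower A, ¬ IsZero (T.ring d).X ∧ IsZero (T.ring (d + 1)).X

/-- The ring `A^{[2]} = T.ring 2` of a splitting tower of `A`, as a ring object of `A`-modules
via the structure morphism `A ≅ T.ring 1 ⟶ T.ring 2`. -/
noncomputable def SplittingTower.secondOver [IsIdempotentComplete C] {A : Mon C} [IsTTRing A.X]
    (T : SplittingTower A) : Mon (Mod C A.X) :=
  haveI := T.isTTRing 2
  algRing (T.ringOne.inv ≫ T.map 1).hom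

end tower

section ttcat

/-- A tensor triangulated category: triangulated, idempotent complete, with a symmetric monoidal
structure whose tensor product is exact in each variable. -/
class TTCategory (K : Type u) [Category.{v} K] [Preadditive K] [HasZeroObject K] [HasShift K ℤ]
    [∀ n : ℤ, (shiftFunctor K n).Additive] [Pretriangulated K] [MonoidalCategory K]
    [SymmetricCategory K] : Prop extends IsTriangulated K, IsIdempotentComplete K where
  exact_left (X : K) : ∃ _ : (tensorLeft X).CommShift ℤ, (tensorLeft X).IsTriangulated
  exact_right (X : K) : ∃ _ : (tensorRight X).CommShift ℤ, (tensorRight X).IsTriangulated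

variable {K : Type u} [Category.{v} K] [Preadditive K] [HasZeroObject K] [HasShift K ℤ]
  [∀ n : ℤ, (shiftFunctor K n).Additive] [Pretriangulated K] [MonoidalCategory K]
  [SymmetricCategory K] [TTCategory K]

instance : MonoidalPreadditive K :=
  haveI hl (X : K) : (tensorLeft X).Additive := by
    obtain ⟨_, _⟩ := TTCategory.exact_left X
    infer_instance
  haveI hr (X : K) : (tensorRight X).Additive := by
    obtain ⟨_, _⟩ := TTCategory.exact_right X
    infer_instance
  { whiskerLeft_zero := (tensorLeft _).map_zero _ _
    zero_whiskerRight := (tensorRight _).map_zero _ _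
    whiskerLeft_add := fun _ _ => (tensorLeft _).map_add
    add_whiskerRight := fun _ _ => (tensorRight _).map_add }

end ttcat
end TTRings

open TTRings

/-! A tower step `A^{[n+1]} ⊗_{A^{[n]}} A^{[n+1]} ≅ A^{[n+1]} × A^{[n+2]}` is governed by two ring
morphisms `m, s : A^{[n+1]} ⟶ A^{[n+2]}`: a ring morphism out of `B ⊗ B` is determined on the two
factors, so the isomorphism must read `b ⊗ b' ↦ (b b', m(b) s(b'))`, where `m` is the tower map.
This normal form (`SplittingTower.exists_stepMap`) mentions only ring morphisms, so it can be moved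
from the base category to `A`-modules.

For the first step the base ring is the unit, hence `A ⊗ A ≅ A × A^{[2]}`. Read `A`-linearly through
the left factor, this is `F_A(A) ≅ 𝟙 × A^{[2]}`, with first component the multiplication of `A`
(`SplittingTower.exists_ext_iso`). As that component is the same for every tower, the unit factor
cancels, and `A^{[2]}` does not depend on the tower (`SplittingTower.nonempty_secondOver_iso`).

For the degree, the rings `A^{[n+1]}`, seen over `A`, form a splitting tower of `A^{[2]}`
(`SplittingTower.shift`). The point is that `B ⊗_R B` is the same whether formed in the base
category or in `A`-modules (`isRelativeTensor_of_base`); the proof uses that separability makes `B ⊗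
B ⟶ B ⊗_R B` a split epimorphism. Vanishing is detected on underlying objects, so re-indexing by one
lowers the degree by one. -/

namespace TTRings

/-! ### Ring objects of `A`-modules, handled through their underlying multiplication. -/

section algebra

variable {C : Type u} [Category.{v} C] [MonoidalCategory C] [SymmetricCategory C]

/-- Commutativity is what makes `ac · bd = ab · cd`. Both `extDesc` and `stepMap` are ring morphisms
for this reason. -/
lemma isMonHom_mul (B : C) [MonObj B] [IsCommMonObj B] : IsMonHom μ[B] where
  one_hom := by simp [MonObj.tensorObj.one_def, ← unitors_equal]
  mul_hom := by
    simp [MonObj.tensorObj.mul_def, MonObj.mul_mul_mul_comm]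

variable [IsIdempotentComplete C] {A : C} [MonObj A] [IsCommMonObj A] [IsSeparable A]

/-- The multiplication `R ⊗ R ⟶ R` in `C` underlying the multiplication of a ring object `R`
of `A`-modules. -/
noncomputable def baseMul (R : Mon (Mod C A)) : R.X.X ⊗ R.X.X ⟶ R.X.X :=
  pr R.X R.X ≫ μ[R.X].hom

lemma pr_mul (R : Mon (Mod C A)) : pr R.X R.X ≫ μ[R.X].hom = baseMul R := rfl

lemma pr_mul_assoc (R : Mon (Mod C A)) {T : C} (k : R.X.X ⟶ T) :
    pr R.X R.X ≫ μ[R.X].hom ≫ k = baseMul R ≫ k := by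
  rw [baseMul, Category.assoc]

/-- By the unit axiom, `a · x = η(a) x`. Linearity over `A` thus follows from compatibility with
units and products, and can be dropped from what has to be checked. -/
lemma lact_eq (R : Mon (Mod C A)) : lact A R.X.X = η[R.X].hom ▷ R.X.X ≫ baseMul R := by
  have h : (η[R.X] ▷ R.X ≫ μ[R.X]).hom = (λ_ R.X).hom.hom := by rw [MonObj.one_mul]
  rw [← pr_leftUnitor_hom, ← h, Mod.comp_hom', pr_whiskerRight_assoc]
  rfl

/-- A morphism in `C` between ring objects of `A`-modules that respects units and multiplications
is a morphism of ring objects of `A`-modules. -/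
noncomputable def monHomMk {R S : Mon (Mod C A)} (u : R.X.X ⟶ S.X.X)
    (h₁ : η[R.X].hom ≫ u = η[S.X].hom) (h₂ : baseMul R ≫ u = (u ⊗ₘ u) ≫ baseMul S) :
    R ⟶ S where
  hom :=
    { hom := u
      isModHom := isModHom_mk _ _ <| by
        rw [lact_eq, lact_eq, Category.assoc, h₂, ← h₁]
        simp [MonoidalCategory.tensorHom_def', whisker_exchange_assoc] }
  isMonHom_hom :=
    { one_hom := Mod.hom_ext _ _ h₁
      mul_hom := by
        apply tensor_ext
        rw [Mod.comp_hom', Mod.comp_hom', pr_tensorHom_assoc, pr_mul_assoc, pr_mul]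
        exact h₂ }

/-- A bimodule section in `C`, followed by the projection `R ⊗ R ⟶ R ⊗_A R`, is a bimodule section
in `A`-modules: each identity is tested after precomposing with the epimorphism `pr`. -/
lemma isTTRing_of_base (R : Mon (Mod C A)) (σ : R.X.X ⟶ R.X.X ⊗ R.X.X)
    (hc : (β_ R.X.X R.X.X).hom ≫ baseMul R = baseMul R)
    (hσ : σ ≫ baseMul R = 𝟙 _)
    (hl : baseMul R ≫ σ = (R.X.X ◁ σ) ≫ (α_ R.X.X R.X.X R.X.X).inv ≫ (baseMul R ▷ R.X.X))
    (hr : baseMul R ≫ σ = (σ ▷ R.X.X) ≫ (α_ R.X.X R.X.X R.X.X).hom ≫ (R.X.X ◁ baseMul R)) :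
    IsTTRing R.X where
  mul_comm := by
    apply tensor_ext
    rw [Mod.comp_hom', pr_braiding_assoc, pr_mul, hc]
  exists_section := by
    let σ' : R.X ⟶ R.X ⊗ R.X :=
      { hom := σ ≫ pr R.X R.X
        -- The ring `A` acts through its image in `R`, so left `R`-linearity of `σ` implies
        -- `A`-linearity.
        isModHom := isModHom_mk _ _ <| by
          have h : A ◁ pr R.X R.X ≫ lact A (R.X ⊗ R.X).X =
            (α_ A R.X.X R.X.X).inv ≫ lact A R.X.X ▷ R.X.X ≫ pr R.X R.X :=
            tensπ_lact A R.X.X R.X.X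
          rw [whiskerLeft_comp, Category.assoc, h, lact_eq, Category.assoc, reassoc_of% hl,
            ← whisker_exchange_assoc]
          simp
          rfl }
    have hσ' : σ'.hom = σ ≫ pr R.X R.X := rfl
    refine ⟨σ', ?_, ?_, ?_⟩
    · ext
      rw [Mod.comp_hom', hσ', Category.assoc, pr_mul, hσ]
      rfl
    · apply tensor_ext
      simp only [Mod.comp_hom']
      rw [pr_mul_assoc, hσ', pr_whiskerLeft_assoc, hσ', whiskerLeft_comp_assoc,
        pr_associator_inv_assoc, pr_whiskerRight, ← comp_whiskerRight_assoc, pr_mul,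
        reassoc_of% hl]
    · apply tensor_ext
      simp only [Mod.comp_hom']
      rw [pr_mul_assoc, hσ', pr_whiskerRight_assoc, hσ', comp_whiskerRight_assoc,
        pr_associator_hom_assoc, pr_whiskerLeft, ← whiskerLeft_comp_assoc, pr_mul,
        reassoc_of% hr]

section

variable {B : C} [MonObj B] [IsCommMonObj B] (f : A ⟶ B) [IsMonHom f]

lemma baseMul_algRing : baseMul (algRing f) = μ[B] :=
  pr_algMul f

end

variable {B : C} [MonObj B] [IsTTRing B] (f : A ⟶ B) [IsMonHom f]

instance isTTRing_algRing : IsTTRing (algRing f).X := by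
  obtain ⟨σ, hσ, hl, hr⟩ := IsSeparable.exists_section (A := B)
  refine isTTRing_of_base (algRing f) σ ?_ ?_ ?_ ?_ <;> rw [baseMul_algRing f]
  exacts [IsCommMonObj.mul_comm B, hσ, hl, hr]

/-- A morphism of `A`-algebras, seen as a morphism of ring objects of `A`-modules. -/
noncomputable def algMap {B B' : C} [MonObj B] [IsCommMonObj B] [MonObj B'] [IsCommMonObj B']
    {f : A ⟶ B} [IsMonHom f] {f' : A ⟶ B'} [IsMonHom f'] (u : B ⟶ B') [IsMonHom u]
    (h : f ≫ u = f') : algRing f ⟶ algRing f' :=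
  monHomMk (R := algRing f) (S := algRing f') u h <| by
    rw [baseMul_algRing, baseMul_algRing]
    exact IsMonHom.mul_hom u

lemma baseMul_trivial : baseMul (Mon.trivial (Mod C A)) = μ[A] :=
  pr_leftUnitor_hom (𝟙_ (Mod C A))

lemma isIso_of_base {R S : Mon (Mod C A)} (f : R ⟶ S) (hf : IsIso f.hom.hom) : IsIso f := by
  have : IsModHom A (asIso f.hom.hom).hom := f.hom.isModHom
  have : IsIso f.hom := by
    rw [show f.hom = (modIso (asIso f.hom.hom)).hom from rfl]
    infer_instance
  have : IsIso ((Mon.forget (Mod C A)).map f) := this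
  exact isIso_of_reflects_iso f (Mon.forget (Mod C A))

/-- An `A`-algebra with invertible structure morphism is the trivial ring object of `A`-modules. -/
lemma nonempty_algRing_iso_trivial {B : C} [MonObj B] [IsCommMonObj B] (f : A ⟶ B) [IsMonHom f]
    [IsIso f] : Nonempty (algRing f ≅ Mon.trivial (Mod C A)) := by
  let u : Mon.trivial (Mod C A) ⟶ algRing f := monHomMk (S := algRing f) f (Category.id_comp f) <| by
    rw [baseMul_trivial, baseMul_algRing]
    exact IsMonHom.mul_hom f
  have : IsIso u := isIso_of_base u ‹IsIso f›
  exact ⟨(asIso u).symm⟩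

attribute [local instance] freeModObj

/-- The morphism of ring objects `F_A(R) ⟶ B`, `a ⊗ r ↦ f(a) g(r)`, for an `A`-algebra `f : A ⟶ B`
and a morphism of ring objects `g : R ⟶ B`. -/
noncomputable def extDesc {B : C} [MonObj B] [IsCommMonObj B] (f : A ⟶ B) [IsMonHom f]
    (R : Mon C) (g : R.X ⟶ B) [IsMonHom g] : (extFunctor A).mapMon.obj R ⟶ algRing f :=
  haveI := isMonHom_mul B
  have h : IsMonHom ((f ⊗ₘ g) ≫ μ[B]) := inferInstance
  monHomMk (S := algRing f) ((f ⊗ₘ g) ≫ μ[B])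
    (by
      change ((ρ_ A).inv ≫ A ◁ η[R.X]) ≫ (f ⊗ₘ g) ≫ μ[B] = f
      simp [MonoidalCategory.tensorHom_def', ← whiskerLeft_comp_assoc, whisker_exchange_assoc])
    (by
      -- Although `F_A(R)` is multiplied over `A`, its underlying ring is the tensor product ring `A
      -- ⊗ R`; multiplicativity is then that of `h`.
      have h' : baseMul ((extFunctor A).mapMon.obj R) = μ[A ⊗ R.X] := by
        change tensπ A (A ⊗ R.X) (A ⊗ R.X) ≫ extMul A R.X R.X ≫ A ◁ μ[R.X] = _
        rw [reassoc_of% tensπ_extMul, ← MonoidalCategory.tensorHom_def]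
        rfl
      rw [h', baseMul_algRing]
      exact h.mul_hom)

end algebra

/-! ### Products of ring objects and cancellation of a common factor. -/

section prod

variable {D : Type u} [Category.{v} D] [MonoidalCategory D] [Preadditive D]
  [HasBinaryBiproducts D] {R S P : Mon D}

variable (R S) in
/-- The first projection of a product of ring objects. -/
noncomputable def prodFst : prodRing R S ⟶ R where
  hom := biprod.fst
  isMonHom_hom :=
    { one_hom := biprod.lift_fst _ _
      mul_hom := biprod.lift_fst _ _ }

variable (R S) in
/-- The second projection of a product of ring objects. -/
noncomputable def prodSnd : prodRing R S ⟶ S where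
  hom := biprod.snd
  isMonHom_hom :=
    { one_hom := biprod.lift_snd _ _
      mul_hom := biprod.lift_snd _ _ }

variable (R S) in
/-- The inclusion of the second factor of a product of ring objects. -/
noncomputable def prodInr : S.X ⟶ (prodRing R S).X := biprod.inr

@[simp]
lemma prodInr_fst : prodInr R S ≫ (prodFst R S).hom = 0 := biprod.inr_fst

@[simp]
lemma prodInr_snd : prodInr R S ≫ (prodSnd R S).hom = 𝟙 _ := biprod.inr_snd

lemma prodRing_hom_ext {T : D} {f g : T ⟶ (prodRing R S).X}
    (h₁ : f ≫ (prodFst R S).hom = g ≫ (prodFst R S).hom)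
    (h₂ : f ≫ (prodSnd R S).hom = g ≫ (prodSnd R S).hom) : f = g :=
  biprod.hom_ext _ _ h₁ h₂

/-- The morphism into a product of ring objects with given components. -/
noncomputable def prodLift (f : P ⟶ R) (g : P ⟶ S) : P ⟶ prodRing R S :=
  let t : P.X ⟶ (prodRing R S).X := biprod.lift f.hom g.hom
  have h₁ : t ≫ (prodFst R S).hom = f.hom := biprod.lift_fst _ _
  have h₂ : t ≫ (prodSnd R S).hom = g.hom := biprod.lift_snd _ _
  { hom := t
    isMonHom_hom :=
      { one_hom := by
          apply prodRing_hom_ext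
          · rw [Category.assoc, h₁, IsMonHom.one_hom, IsMonHom.one_hom]
          · rw [Category.assoc, h₂, IsMonHom.one_hom, IsMonHom.one_hom]
        mul_hom := by
          apply prodRing_hom_ext
          · rw [Category.assoc, h₁, Category.assoc, IsMonHom.mul_hom, IsMonHom.mul_hom,
              tensorHom_comp_tensorHom_assoc, h₁]
          · rw [Category.assoc, h₂, Category.assoc, IsMonHom.mul_hom, IsMonHom.mul_hom,
              tensorHom_comp_tensorHom_assoc, h₂] } }

@[simp]
lemma prodLift_fst (f : P ⟶ R) (g : P ⟶ S) : prodLift f g ≫ prodFst R S = f :=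
  Mon.Hom.ext (biprod.lift_fst _ _)

@[simp]
lemma prodLift_snd (f : P ⟶ R) (g : P ⟶ S) : prodLift f g ≫ prodSnd R S = g :=
  Mon.Hom.ext (biprod.lift_snd _ _)

/-- A morphism of objects that is multiplicative and invertible is a morphism of ring objects. -/
lemma isMonHom_of_isIso {X Y : D} [MonObj X] [MonObj Y] (f : X ⟶ Y) [IsIso f]
    (hf : μ[X] ≫ f = (f ⊗ₘ f) ≫ μ[Y]) : IsMonHom f where
  one_hom := by
    -- With `e = f(1)`, multiplicativity gives `e f(x) = f(x)`; invertibility of `f` gives `e y = y`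
    -- for all `y`; finally `y = 1` gives `e = 1`.
    have h : (λ_ X).inv ≫ (η[X] ≫ f) ▷ X ≫ Y ◁ f ≫ μ[Y] = f := by
      rw [comp_whiskerRight_assoc, ← tensorHom_def_assoc, ← hf]
      simp
    have h2 : (λ_ Y).inv ≫ (η[X] ≫ f) ▷ Y ≫ μ[Y] = 𝟙 Y := by
      rw [← cancel_epi f, leftUnitor_inv_naturality_assoc, whisker_exchange_assoc, h]
      simp
    have h3 := congr(η[Y] ≫ $h2)
    rw [leftUnitor_inv_naturality_assoc, whisker_exchange_assoc, MonObj.mul_one] at h3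
    simpa [← unitors_equal] using h3
  mul_hom := hf

variable [MonoidalPreadditive D]

/-- The inclusion of a factor respects products but in general not units, so it is only a morphism
of objects. -/
lemma prodInr_mul : (prodInr R S ⊗ₘ prodInr R S) ≫ μ[(prodRing R S).X] =
    μ[S.X] ≫ prodInr R S := by
  apply prodRing_hom_ext
  · rw [Category.assoc, IsMonHom.mul_hom, tensorHom_comp_tensorHom_assoc]
    simp [MonoidalCategory.tensorHom_def]
  · rw [Category.assoc, IsMonHom.mul_hom]
    simp

/-- If `R × S ≅ R × S'` as ring objects over `R`, then `S ≅ S'`. -/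
lemma nonempty_iso_of_prod_iso {S' : Mon D} (e : prodRing R S ≅ prodRing R S')
    (he : e.hom ≫ prodFst R S' = prodFst R S) : Nonempty (S ≅ S') := by
  have he' : e.inv ≫ prodFst R S = prodFst R S' := by
    rw [← he, Iso.inv_hom_id_assoc]
  -- As `e` respects the projections to `R`, it sends `0 × S` into `0 × S'`. Applied to the
  -- isomorphism and to its inverse, this makes the two restrictions mutually inverse.
  have key (S S' : Mon D) (e : prodRing R S ⟶ prodRing R S')
      (he : e ≫ prodFst R S' = prodFst R S) :
      (prodInr R S ≫ e.hom ≫ (prodSnd R S').hom) ≫ prodInr R S' = prodInr R S ≫ e.hom := by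
    apply prodRing_hom_ext
    · simp [← Mon.comp_hom', he]
    · simp
  let t : S.X ≅ S'.X :=
    { hom := prodInr R S ≫ e.hom.hom ≫ (prodSnd R S').hom
      inv := prodInr R S' ≫ e.inv.hom ≫ (prodSnd R S).hom
      hom_inv_id := by
        rw [← Category.assoc, key S S' e.hom he, Category.assoc, ← Category.assoc e.hom.hom,
          ← Mon.comp_hom', e.hom_inv_id]
        simp
      inv_hom_id := by
        rw [← Category.assoc, key S' S e.inv he', Category.assoc, ← Category.assoc e.inv.hom,
          ← Mon.comp_hom', e.inv_hom_id]
        simp }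
  have : IsIso t.hom := t.isIso_hom
  -- `t` is not a composite of unital maps, as `prodInr` need not preserve units; only its
  -- multiplicativity is read off, and invertibility supplies the unit.
  have : IsMonHom t.hom := isMonHom_of_isIso t.hom <| by
    change μ[S.X] ≫ prodInr R S ≫ e.hom.hom ≫ (prodSnd R S').hom =
      ((prodInr R S ≫ e.hom.hom ≫ (prodSnd R S').hom) ⊗ₘ
        (prodInr R S ≫ e.hom.hom ≫ (prodSnd R S').hom)) ≫ _
    rw [← tensorHom_comp_tensorHom, ← tensorHom_comp_tensorHom, Category.assoc, Category.assoc,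
      ← IsMonHom.mul_hom, ← IsMonHom.mul_hom_assoc, reassoc_of% prodInr_mul]
  exact ⟨Mon.mkIso' t⟩

end prod

/-! ### The normal form of a step of a splitting tower. -/

section step

variable {D : Type u} [Category.{v} D] [MonoidalCategory D] [SymmetricCategory D]

/-- The endomorphism `proj` built from the separability of `R` is balanced, so it factors as `q ≫
s`; as it fixes balanced maps, `q ≫ s ≫ q = q`, and `s` is a section. Unlike a general coequalizer,
a split epimorphism stays epi after tensoring. -/
lemma relativeTensor_isSplitEpi [IsIdempotentComplete D] {R B P : Mon D}
    [IsTTRing R.X] [IsCommMonObj B.X] {f : R ⟶ B} {q : B ⊗ B ⟶ P} (h : IsRelativeTensor f q) :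
    IsSplitEpi q.hom := by
  obtain ⟨w, ⟨hq⟩⟩ := h
  let : ModObj R.X B.X := (algMod f.hom).mod
  have hl : lact R.X B.X = f.hom ▷ B.X ≫ μ[B.X] := rfl
  have hr : ract R.X B.X = B.X ◁ f.hom ≫ μ[B.X] := ract_alg hl
  have hb : Balanced R.X B.X B.X q.hom := by
    rw [Balanced, hl, hr, w, Category.assoc]
  have hp := proj_balanced R.X B.X B.X
  rw [Balanced, hl, hr, ← Category.assoc (α_ _ _ _).hom] at hp
  obtain ⟨s, hs⟩ := Cofork.IsColimit.desc' hq _ hp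
  have hs' : q.hom ≫ s = proj R.X B.X B.X := hs
  refine ⟨⟨⟨s, Cofork.IsColimit.hom_ext hq ?_⟩⟩⟩
  change q.hom ≫ s ≫ q.hom = q.hom ≫ 𝟙 _
  rw [reassoc_of% hs', hb.proj_comp, Category.comp_id]

lemma IsRelativeTensor.comp_iso {R B P P' : Mon D} {f : R ⟶ B} {q : B ⊗ B ⟶ P}
    (h : IsRelativeTensor f q) (e : P ≅ P') : IsRelativeTensor f (q ≫ e.hom) := by
  obtain ⟨w, ⟨hq⟩⟩ := h
  refine ⟨by rw [Mon.comp_hom', reassoc_of% w, Category.assoc], ⟨?_⟩⟩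
  exact hq.ofIsoColimit (Cofork.ext ((Mon.forget D).mapIso e) rfl)

/-- The multiplication of a commutative ring object as a morphism of ring objects. -/
def mulHom (B : Mon D) [IsCommMonObj B.X] : B ⊗ B ⟶ B where
  hom := μ[B.X]
  isMonHom_hom := isMonHom_mul B.X

/-- The unit of a ring object as a morphism of ring objects. -/
def unitHom (B : Mon D) : 𝟙_ (Mon D) ⟶ B := (default : Mon.trivial D ⟶ B)

/-- In elements, `(x ⊗ 1)(1 ⊗ y) = x ⊗ y`. -/
lemma incl_tensor_incl_mul (X Y : D) [MonObj X] [MonObj Y] :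
    (((ρ_ X).inv ≫ X ◁ η[Y]) ⊗ₘ ((λ_ Y).inv ≫ η[X] ▷ Y)) ≫ μ[X ⊗ Y] = 𝟙 (X ⊗ Y) := by
  have h := tensorμ_natural (𝟙 X) η[Y] η[X] (𝟙 Y)
  rw [MonObj.tensorObj.mul_def, ← tensorHom_comp_tensorHom, ← id_tensorHom, ← tensorHom_id,
    Category.assoc, reassoc_of% h, tensorHom_comp_tensorHom, id_tensorHom, tensorHom_id,
    MonObj.mul_one, MonObj.one_mul]
  simp only [tensorμ, braiding_tensorUnit_left]
  monoidal

/-- A morphism of ring objects out of `X ⊗ Y` is determined by its restrictions to the factors. -/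
lemma tensor_incl_mul {X Y Z : D} [MonObj X] [MonObj Y] [MonObj Z] (t : X ⊗ Y ⟶ Z) [IsMonHom t] :
    (((ρ_ X).inv ≫ X ◁ η[Y] ≫ t) ⊗ₘ ((λ_ Y).inv ≫ η[X] ▷ Y ≫ t)) ≫ μ[Z] = t := by
  have h := incl_tensor_incl_mul X Y
  rw [← Category.assoc, ← Category.assoc (λ_ Y).inv, ← tensorHom_comp_tensorHom, Category.assoc,
    ← IsMonHom.mul_hom, reassoc_of% h]

variable [Preadditive D] [HasBinaryBiproducts D]

/-- The morphism `b ⊗ b' ↦ (b b', m(b) s(b'))` of ring objects `B ⊗ B ⟶ B × S`. -/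
noncomputable def stepMap {B S : Mon D} [IsCommMonObj B.X] [IsCommMonObj S.X] (m s : B ⟶ S) :
    B ⊗ B ⟶ prodRing B S :=
  prodLift (mulHom B) ((m ⊗ₘ s) ≫ mulHom S)

lemma stepMap_fst {B S : Mon D} [IsCommMonObj B.X] [IsCommMonObj S.X] (m s : B ⟶ S) :
    (stepMap m s).hom ≫ (prodFst B S).hom = μ[B.X] := biprod.lift_fst _ _

lemma stepMap_snd {B S : Mon D} [IsCommMonObj B.X] [IsCommMonObj S.X] (m s : B ⟶ S) :
    (stepMap m s).hom ≫ (prodSnd B S).hom = (m.hom ⊗ₘ s.hom) ≫ μ[S.X] := biprod.lift_snd _ _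

/-- Since `s(1) = 1`, the element `b ⊗ 1` goes to `m(b)`. This is the algebra condition in the
definition of a splitting tower, automatic for maps in normal form. -/
lemma stepMap_incl {B S : Mon D} [IsCommMonObj B.X] [IsCommMonObj S.X] (m s : B ⟶ S) :
    (ρ_ B.X).inv ≫ B.X ◁ η[B.X] ≫ (stepMap m s).hom ≫ (prodSnd B S).hom = m.hom := by
  rw [stepMap_snd, tensorHom_def'_assoc, ← whiskerLeft_comp_assoc, IsMonHom.one_hom,
    whisker_exchange_assoc, MonObj.mul_one]
  simp

variable {A : Mon D}

instance (T : SplittingTower A) (n : ℕ) : IsTTRing (T.ring n).X := T.isTTRing n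

/-- The second component of the step isomorphism is a ring morphism on `B ⊗ B`, hence the product of
its restrictions to the factors. The algebra condition identifies the left one with the tower map;
the right one is `s`. -/
lemma SplittingTower.exists_stepMap (T : SplittingTower A) (n : ℕ) :
    ∃ s : T.ring (n + 1) ⟶ T.ring (n + 2),
      IsRelativeTensor (T.map n) (stepMap (T.map (n + 1)) s) := by
  obtain ⟨P, q, h, hq, h₁, h₂⟩ := T.step n
  let t : T.ring (n + 1) ⊗ T.ring (n + 1) ⟶ T.ring (n + 2) := q ≫ h.hom ≫ prodSnd _ _
  -- The witness is `b' ↦ t(1 ⊗ b')`.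
  refine ⟨(λ_ _).inv ≫ unitHom (T.ring (n + 1)) ▷ T.ring (n + 1) ≫ t, ?_⟩
  have ht : (T.map (n + 1) ⊗ₘ
      ((λ_ _).inv ≫ unitHom (T.ring (n + 1)) ▷ T.ring (n + 1) ≫ t)) ≫ mulHom _ = t := by
    have := tensor_incl_mul t.hom
    ext
    refine Eq.trans ?_ this
    rw [show (ρ_ (T.ring (n + 1)).X).inv ≫ (T.ring (n + 1)).X ◁ η[(T.ring (n + 1)).X] ≫ t.hom =
      (T.map (n + 1)).hom from h₂]
    rfl
  have hs : stepMap (T.map (n + 1)) ((λ_ _).inv ≫ unitHom _ ▷ _ ≫ t) = q ≫ h.hom := by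
    apply Mon.Hom.ext
    apply prodRing_hom_ext
    · rw [stepMap_fst]
      exact h₁.symm.trans (Category.assoc _ _ _).symm
    · rw [stepMap_snd]
      exact congr(($ht).hom).trans (Category.assoc _ _ _).symm
  rw [hs]
  exact hq.comp_iso h

/-- Over the unit ring both actions on `B ⊗ B` are the unit constraint, and a coequalizer of two
equal morphisms is an isomorphism. -/
lemma isIso_of_isRelativeTensor_trivial {R B P : Mon D} (e : R ≅ Mon.trivial D) {f : R ⟶ B}
    {q : B ⊗ B ⟶ P} (h : IsRelativeTensor f q) : IsIso q.hom := by
  obtain ⟨w, ⟨hq⟩⟩ := h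
  refine isIso_colimit_cocone_parallelPair_of_eq ?_ hq
  obtain ⟨u, hu⟩ : ∃ u : R.X ⟶ 𝟙_ D, f.hom = u ≫ η[B.X] := by
    refine ⟨e.hom.hom, ?_⟩
    -- The unit ring is initial, so `f` is forced to be the unit of `B` up to `e`.
    have hf : e.inv ≫ f = default := Subsingleton.elim _ _
    rw [Iso.inv_comp_eq] at hf
    rw [hf]
    rfl
  rw [hu, comp_whiskerRight_assoc, MonObj.one_mul, whiskerLeft_comp_assoc, MonObj.mul_one]
  simp

end step

/-! ### Relative tensor products in `A`-modules compared with those in the base category. -/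

section modules

variable {C : Type u} [Category.{v} C] [MonoidalCategory C]

/-- The morphism `q : B ⊗ B ⟶ P` is a coequalizer of the two morphisms `B ⊗ R ⊗ B ⇉ B ⊗ B` given
by `f : R ⟶ B` and the multiplication `m` of `B`. -/
def IsBalancedQuotient {R B P : C} (m : B ⊗ B ⟶ B) (f : R ⟶ B) (q : B ⊗ B ⟶ P) : Prop :=
  ∃ w : ((B ◁ f ≫ m) ▷ B) ≫ q = ((α_ B R B).hom ≫ B ◁ (f ▷ B ≫ m)) ≫ q,
    Nonempty (IsColimit (Cofork.ofπ q w))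

lemma IsBalancedQuotient.comp_iso {R B P P' : C} {m : B ⊗ B ⟶ B} {f : R ⟶ B} {q : B ⊗ B ⟶ P}
    (h : IsBalancedQuotient m f q) (e : P ≅ P') : IsBalancedQuotient m f (q ≫ e.hom) := by
  obtain ⟨w, ⟨hq⟩⟩ := h
  refine ⟨by rw [reassoc_of% w, Category.assoc], ⟨?_⟩⟩
  exact hq.ofIsoColimit (Cofork.ext e rfl)

variable [SymmetricCategory C]

variable [IsIdempotentComplete C] {A : C} [MonObj A] [IsCommMonObj A] [IsSeparable A]

/-- A morphism out of `B ⊗_A B` coequalizes the two `R`-actions exactly when its pullback to `B ⊗ B`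
does, because the projections are epimorphisms. The factorization found in `C` is then shown to be
`A`-linear. -/
lemma isRelativeTensor_of_base {R B P : Mon (Mod C A)} {f : R ⟶ B} {q : B ⊗ B ⟶ P}
    (h : IsBalancedQuotient (baseMul B) f.hom.hom (pr B.X B.X ≫ q.hom.hom))
    (_ : IsSplitEpi (pr B.X B.X ≫ q.hom.hom)) : IsRelativeTensor f q := by
  obtain ⟨w, ⟨hc⟩⟩ := h
  have hpair {T : Mod C A} (g : B.X ⊗ B.X ⟶ T) :
      (B.X ◁ f.hom ≫ μ[B.X]) ▷ B.X ≫ g =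
        ((α_ B.X R.X B.X).hom ≫ B.X ◁ (f.hom ▷ B.X ≫ μ[B.X])) ≫ g ↔
      (B.X.X ◁ f.hom.hom ≫ baseMul B) ▷ B.X.X ≫ pr _ _ ≫ g.hom =
        ((α_ _ _ _).hom ≫ B.X.X ◁ (f.hom.hom ▷ B.X.X ≫ baseMul B)) ≫ pr _ _ ≫ g.hom := by
    have h₁ : pr B.X R.X ▷ B.X.X ≫ pr (B.X ⊗ R.X) B.X ≫
        ((B.X ◁ f.hom ≫ μ[B.X]) ▷ B.X ≫ g).hom =
        (B.X.X ◁ f.hom.hom ≫ baseMul B) ▷ B.X.X ≫ pr _ _ ≫ g.hom := by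
      rw [Mod.comp_hom', pr_whiskerRight_assoc, ← comp_whiskerRight_assoc, Mod.comp_hom',
        pr_whiskerLeft_assoc, pr_mul]
    have h₂ : pr B.X R.X ▷ B.X.X ≫ pr (B.X ⊗ R.X) B.X ≫
        (((α_ B.X R.X B.X).hom ≫ B.X ◁ (f.hom ▷ B.X ≫ μ[B.X])) ≫ g).hom =
        ((α_ _ _ _).hom ≫ B.X.X ◁ (f.hom.hom ▷ B.X.X ≫ baseMul B)) ≫ pr _ _ ≫ g.hom := by
      rw [Category.assoc, Mod.comp_hom', Mod.comp_hom', pr_associator_hom_assoc,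
        pr_whiskerLeft_assoc, ← whiskerLeft_comp_assoc, Mod.comp_hom', pr_whiskerRight_assoc,
        pr_mul, Category.assoc]
    rw [← h₁, ← h₂]
    exact ⟨fun h => by rw [h], tensor_ext₃⟩
  refine ⟨(hpair q.hom).2 w, ⟨Cofork.IsColimit.mk' _ fun s => ?_⟩⟩
  obtain ⟨d, hd⟩ := Cofork.IsColimit.desc' hc _ ((hpair s.π).1 s.condition)
  have hd' : (pr B.X B.X ≫ q.hom.hom) ≫ d = pr B.X B.X ≫ s.π.hom := hd
  rw [Category.assoc, cancel_epi] at hd'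
  -- Splitness enters here: the composite with `pr` remains an epimorphism after tensoring with `A`,
  -- so the linearity of `d` can be tested on `A ⊗ (B ⊗_A B)`.
  have hepi : Epi (A ◁ q.hom.hom) := by
    refine epi_of_epi_fac (f := A ◁ pr B.X B.X) (h := A ◁ (pr B.X B.X ≫ q.hom.hom)) ?_
    rw [whiskerLeft_comp]
  have hepi' : Epi q.hom.hom := epi_of_epi_fac (f := pr B.X B.X) rfl
  refine ⟨{ hom := d, isModHom := isModHom_mk _ _ ?_ }, Mod.hom_ext _ _ hd', fun {m} hm => ?_⟩
  · change lact A P.X.X ≫ d = A ◁ d ≫ lact A s.pt.X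
    rw [← cancel_epi (A ◁ q.hom.hom), ← reassoc_of% (lact_hom q.hom.hom), hd', lact_hom,
      ← whiskerLeft_comp_assoc, hd']
  · ext
    rw [← cancel_epi q.hom.hom]
    exact congr(($hm).hom).trans hd'.symm

variable [Preadditive C] [MonoidalPreadditive C] [HasBinaryBiproducts C]

/-- The underlying object of a biproduct of modules is the biproduct of the underlying objects. -/
noncomputable def biprodBaseIso (M N : Mod C A) : (M ⊞ N).X ≅ M.X ⊞ N.X where
  hom := biprod.lift (biprod.fst : M ⊞ N ⟶ M).hom (biprod.snd : M ⊞ N ⟶ N).hom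
  inv := biprod.desc (biprod.inl : M ⟶ M ⊞ N).hom (biprod.inr : N ⟶ M ⊞ N).hom
  hom_inv_id := by
    rw [biprod.lift_desc, ← Mod.comp_hom', ← Mod.comp_hom', ← add_hom, biprod.total]
    rfl
  inv_hom_id := by
    apply biprod.hom_ext' <;> apply biprod.hom_ext <;> simp [← Mod.comp_hom']

/-- The underlying object of a product of ring objects of `A`-modules is the biproduct of the
underlying objects. -/
noncomputable def prodRingBaseIso (R S : Mon (Mod C A)) :
    (prodRing R S).X.X ≅ R.X.X ⊞ S.X.X :=
  biprodBaseIso R.X S.X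

lemma comp_prodRingBaseIso {R S : Mon (Mod C A)} {T : C} (g : T ⟶ (prodRing R S).X.X) :
    g ≫ (prodRingBaseIso R S).hom =
      biprod.lift (g ≫ (prodFst R S).hom.hom) (g ≫ (prodSnd R S).hom.hom) := by
  have h₁ : (prodRingBaseIso R S).hom ≫ biprod.fst = (prodFst R S).hom.hom := biprod.lift_fst _ _
  have h₂ : (prodRingBaseIso R S).hom ≫ biprod.snd = (prodSnd R S).hom.hom := biprod.lift_snd _ _
  apply biprod.hom_ext <;> simp [h₁, h₂]

lemma pr_stepMap {B S : Mon (Mod C A)} [IsCommMonObj B.X] [IsCommMonObj S.X] (m s : B ⟶ S) :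
    (pr B.X B.X ≫ (stepMap m s).hom.hom) ≫ (prodRingBaseIso B S).hom =
      biprod.lift (baseMul B) ((m.hom.hom ⊗ₘ s.hom.hom) ≫ baseMul S) := by
  rw [comp_prodRingBaseIso, Category.assoc, Category.assoc, ← Mod.comp_hom', ← Mod.comp_hom',
    stepMap_fst, stepMap_snd, Mod.comp_hom', pr_tensorHom_assoc]
  rfl

/-- Balancedness at `1 ⊗ r ⊗ 1` identifies the images of `f(r) ⊗ 1` and `1 ⊗ f(r)`, whose second
components are `m(f(r))` and `s(f(r))`. This makes `s` a morphism of algebras whenever `m` is one.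
-/
lemma comp_eq_of_isRelativeTensor_stepMap {R B S : Mon C} [IsCommMonObj B.X] [IsCommMonObj S.X]
    {f : R ⟶ B} {m s : B ⟶ S} (h : IsRelativeTensor f (stepMap m s)) :
    f.hom ≫ m.hom = f.hom ≫ s.hom := by
  obtain ⟨w, -⟩ := h
  have h₁ : (λ_ R.X).inv ≫ η[B.X] ▷ R.X ≫ (ρ_ _).inv ≫ (B.X ⊗ R.X) ◁ η[B.X] ≫
      (B.X ◁ f.hom ≫ μ[B.X]) ▷ B.X = f.hom ≫ (ρ_ B.X).inv ≫ B.X ◁ η[B.X] := by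
    rw [whisker_exchange, ← rightUnitor_inv_naturality_assoc, Category.assoc,
      ← whisker_exchange_assoc, MonObj.one_mul_assoc, leftUnitor_naturality_assoc,
      Iso.inv_hom_id_assoc]
  have h₂ : (λ_ R.X).inv ≫ η[B.X] ▷ R.X ≫ (ρ_ _).inv ≫ (B.X ⊗ R.X) ◁ η[B.X] ≫
      (α_ B.X R.X B.X).hom ≫ B.X ◁ (f.hom ▷ B.X ≫ μ[B.X]) =
        f.hom ≫ (λ_ B.X).inv ≫ η[B.X] ▷ B.X := by
    have h : R.X ◁ η[B.X] ≫ f.hom ▷ B.X ≫ μ[B.X] = (ρ_ _).hom ≫ f.hom := by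
      rw [whisker_exchange_assoc, MonObj.mul_one, rightUnitor_naturality]
    rw [tensor_whiskerLeft_assoc, Iso.inv_hom_id_assoc, ← whiskerLeft_comp, h]
    simp [← whisker_exchange]
  have h₃ : (λ_ B.X).inv ≫ η[B.X] ▷ B.X ≫ (m.hom ⊗ₘ s.hom) ≫ μ[S.X] = s.hom := by
    rw [tensorHom_def_assoc, ← comp_whiskerRight_assoc, IsMonHom.one_hom,
      ← whisker_exchange_assoc, MonObj.one_mul]
    simp
  rw [← stepMap_incl m s, ← h₃, ← stepMap_snd]
  have hw := congr($w ≫ (prodSnd B S).hom)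
  rw [Category.assoc, Category.assoc] at hw
  simp only [← Category.assoc] at h₁ h₂ hw ⊢
  rw [← h₁, ← h₂]
  simp only [Category.assoc] at hw ⊢
  rw [hw]

/-- Pulled back to `B ⊗ B`, the normal form over `A` is given by the same formula as in `C`, up to
identifying the biproduct of modules with that of objects. The hypothesis in `C` thus supplies both
the coequalizer and its splitting. -/
lemma isRelativeTensor_stepMap_algMap {R B S : Mon C} [IsTTRing R.X] [IsTTRing B.X] [IsTTRing S.X]
    {r : A ⟶ R.X} [IsMonHom r] {f : R ⟶ B} {m s : B ⟶ S}
    (h : IsRelativeTensor f (stepMap m s)) {b : A ⟶ B.X} [IsMonHom b] (hb : r ≫ f.hom = b)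
    {t : A ⟶ S.X} [IsMonHom t] (hm : b ≫ m.hom = t) (hs : b ≫ s.hom = t) :
    IsRelativeTensor (algMap f.hom hb) (stepMap (algMap m.hom hm) (algMap s.hom hs)) := by
  have h₁ : pr _ _ ≫ (stepMap (algMap m.hom hm) (algMap s.hom hs)).hom.hom =
      biprod.lift (baseMul (algRing b)) (((algMap m.hom hm).hom.hom ⊗ₘ
        (algMap s.hom hs).hom.hom) ≫ baseMul (algRing t)) ≫ (prodRingBaseIso _ _).inv := by
    rw [← pr_stepMap, Category.assoc, Iso.hom_inv_id, Category.comp_id]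
  have h₂ : IsBalancedQuotient (baseMul (algRing b)) (algMap f.hom hb).hom.hom
      (biprod.lift (baseMul (algRing b)) (((algMap m.hom hm).hom.hom ⊗ₘ
        (algMap s.hom hs).hom.hom) ≫ baseMul (algRing t))) := by
    -- Once the underlying multiplications are those of `B` and `S`, the goal and `h` unfold to the
    -- same statement.
    rw [baseMul_algRing, baseMul_algRing]
    exact h
  have h₃ : IsSplitEpi
      (biprod.lift (baseMul (algRing b)) (((algMap m.hom hm).hom.hom ⊗ₘ
        (algMap s.hom hs).hom.hom) ≫ baseMul (algRing t))) := by
    rw [baseMul_algRing, baseMul_algRing]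
    exact relativeTensor_isSplitEpi h
  apply isRelativeTensor_of_base
  · rw [h₁]
    exact h₂.comp_iso (prodRingBaseIso _ _).symm
  · rw [h₁]
    infer_instance

end modules

/-! ### The decomposition of `F_A(A)` and the shifted tower. -/

section degree

variable {C : Type u} [Category.{v} C] [MonoidalCategory C] [SymmetricCategory C]
  [IsIdempotentComplete C] [Preadditive C] [HasBinaryBiproducts C]
  {A : Mon C} [IsTTRing A.X]

/-- The morphism of ring objects `F_A(A) ⟶ 𝟙` given by the multiplication of `A`. -/
noncomputable def extCounit (A : Mon C) [IsTTRing A.X] :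
    (extFunctor A.X).mapMon.obj A ⟶ Mon.trivial (Mod C A.X) :=
  -- `extDesc` lands in `algRing (𝟙 A.X)`; the second map, the identity on `A`, passes to the unit
  -- ring.
  extDesc (𝟙 A.X) A (𝟙 A.X) ≫
    monHomMk (R := algRing (𝟙 A.X)) (S := Mon.trivial (Mod C A.X)) (𝟙 A.X) (Category.comp_id _) (by
      rw [baseMul_trivial, baseMul_algRing]
      change μ[A.X] ≫ 𝟙 A.X = (𝟙 A.X ⊗ₘ 𝟙 A.X) ≫ μ[A.X]
      simp)

lemma extCounit_hom_hom : (extCounit A).hom.hom = μ[A.X] := by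
  change ((𝟙 A.X ⊗ₘ 𝟙 A.X) ≫ μ[A.X]) ≫ 𝟙 A.X = _
  simp

/-- Needed because the first ring of a tower is only isomorphic to `A`, not equal to it. -/
lemma isIso_lift_mul_of_iso {B S : Mon C} [IsCommMonObj B.X] [IsCommMonObj S.X] (r : B ≅ A)
    (m s : B ⟶ S) [h : IsIso (stepMap m s).hom] :
    IsIso (biprod.lift μ[A.X] (((r.inv ≫ m).hom ⊗ₘ (r.inv ≫ s).hom) ≫ μ[S.X])) := by
  have hr : r.inv.hom ≫ r.hom.hom = 𝟙 A.X := by rw [← Mon.comp_hom', r.inv_hom_id]; rfl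
  have h' : IsIso (biprod.lift μ[B.X] ((m.hom ⊗ₘ s.hom) ≫ μ[S.X])) := h
  have hb : IsIso (biprod.map r.hom.hom (𝟙 S.X)) :=
    (biprod.mapIso ((Mon.forget C).mapIso r) (Iso.refl S.X)).isIso_hom
  have e : biprod.lift μ[A.X] (((r.inv ≫ m).hom ⊗ₘ (r.inv ≫ s).hom) ≫ μ[S.X]) =
      (r.inv.hom ⊗ₘ r.inv.hom) ≫ biprod.lift μ[B.X] ((m.hom ⊗ₘ s.hom) ≫ μ[S.X]) ≫
        biprod.map r.hom.hom (𝟙 S.X) := by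
    apply biprod.hom_ext <;> simp [hr]
  rw [e]
  infer_instance

variable [MonoidalPreadditive C]

/-- `F_A(A) ≅ 𝟙 × A^{[2]}`, with first component given by the multiplication of `A`. -/
lemma SplittingTower.exists_ext_iso (T : SplittingTower A) :
    ∃ e : (extFunctor A.X).mapMon.obj A ≅ prodRing (Mon.trivial (Mod C A.X)) T.secondOver,
      e.hom ≫ prodFst _ _ = extCounit A := by
  obtain ⟨s, hs⟩ := T.exists_stepMap 0
  have hiso : IsIso (stepMap (T.map 1) s).hom :=
    isIso_of_isRelativeTensor_trivial T.ringZero hs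
  -- On elements, `a ⊗ a' ↦ (a a', m(a) s(a'))`: the invertible step map of `C`, made `A`-linear
  -- through the left factor. Its invertibility may be tested in `C`.
  let Φ : (extFunctor A.X).mapMon.obj A ⟶ prodRing (Mon.trivial (Mod C A.X)) T.secondOver :=
    prodLift (extCounit A)
      (extDesc (T.ringOne.inv ≫ T.map 1).hom A (T.ringOne.inv ≫ s).hom)
  suffices h : IsIso Φ.hom.hom by
    have := isIso_of_base Φ h
    exact ⟨asIso Φ, prodLift_fst _ _⟩
  have h₁ : Φ.hom.hom ≫ (prodFst (Mon.trivial (Mod C A.X)) T.secondOver).hom.hom = μ[A.X] :=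
    congr(($(prodLift_fst (extCounit A) _)).hom.hom).trans extCounit_hom_hom
  have h₂ : Φ.hom.hom ≫ (prodSnd (Mon.trivial (Mod C A.X)) T.secondOver).hom.hom =
      ((T.ringOne.inv ≫ T.map 1).hom ⊗ₘ (T.ringOne.inv ≫ s).hom) ≫ μ[(T.ring 2).X] := by
    exact congr(($(prodLift_snd (extCounit A) (extDesc (T.ringOne.inv ≫ T.map 1).hom A
      (T.ringOne.inv ≫ s).hom))).hom.hom)
  have : IsIso (Φ.hom.hom ≫ (prodRingBaseIso _ _).hom) := by
    rw [comp_prodRingBaseIso, h₁, h₂]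
    exact isIso_lift_mul_of_iso T.ringOne (T.map 1) s
  exact IsIso.of_isIso_comp_right _ (prodRingBaseIso _ _).hom

/-- Both decompositions of `F_A(A)` have first component `extCounit A`, so the unit factor cancels.
This compares a given tower with the one provided by `HasDegree`. -/
lemma SplittingTower.nonempty_secondOver_iso (T T' : SplittingTower A) :
    Nonempty (T.secondOver ≅ T'.secondOver) := by
  obtain ⟨e, he⟩ := T.exists_ext_iso
  obtain ⟨e', he'⟩ := T'.exists_ext_iso
  exact nonempty_iso_of_prod_iso (e.symm ≪≫ e') (by
    rw [Iso.trans_hom, Iso.symm_hom, Category.assoc, he', Iso.inv_comp_eq, he])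

/-- The structure morphism `A ⟶ A^{[n+1]}` of a splitting tower. -/
noncomputable def SplittingTower.structureMap (T : SplittingTower A) :
    ∀ n : ℕ, A ⟶ T.ring (n + 1)
  | 0 => T.ringOne.inv
  | n + 1 => T.structureMap n ≫ T.map (n + 1)

lemma SplittingTower.structureMap_comp (T : SplittingTower A) (n : ℕ) :
    (T.structureMap n).hom ≫ (T.map (n + 1)).hom = (T.structureMap (n + 1)).hom := rfl

/-- The ring `A^{[n+1]}` of a splitting tower of `A`, as a ring object of `A`-modules. -/
noncomputable def SplittingTower.ringOver (T : SplittingTower A) (n : ℕ) : Mon (Mod C A.X) :=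
  algRing (T.structureMap n).hom

instance (T : SplittingTower A) (n : ℕ) : IsTTRing (T.ringOver n).X :=
  isTTRing_algRing (T.structureMap n).hom

/-- Shifting a splitting tower of `A` by one gives a splitting tower of `A^{[2]}` in
`A`-modules. -/
noncomputable def SplittingTower.shift (T : SplittingTower A) {R : Mon (Mod C A.X)}
    (e : T.secondOver ≅ R) : SplittingTower R where
  ring := T.ringOver
  isTTRing := inferInstance
  map n := algMap (T.map (n + 1)).hom (T.structureMap_comp n)
  ringZero :=
    haveI : IsIso (T.structureMap 0).hom := inferInstanceAs (IsIso T.ringOne.inv.hom)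
    (nonempty_algRing_iso_trivial (T.structureMap 0).hom).some
  -- Position `n` holds `A^{[n+1]}`, so position `1` is `T.secondOver` by definition. A general `R`
  -- allows this to be a tower for the second ring of another tower.
  ringOne := e
  step n := by
    obtain ⟨s, hs⟩ := T.exists_stepMap (n + 1)
    -- `s` agrees with the tower map on `A^{[n+1]}`, through which `A` maps, so it is a morphism of
    -- `A`-algebras.
    have hs' : (T.structureMap (n + 1)).hom ≫ s.hom = (T.structureMap (n + 2)).hom := by
      have h := comp_eq_of_isRelativeTensor_stepMap hs
      rw [← T.structureMap_comp (n + 1), ← T.structureMap_comp n, Category.assoc, Category.assoc, h]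
    have h := isRelativeTensor_stepMap_algMap hs (T.structureMap_comp n)
      (T.structureMap_comp (n + 1)) hs'
    let m : T.ringOver (n + 1) ⟶ T.ringOver (n + 2) :=
      algMap (T.map (n + 2)).hom (T.structureMap_comp (n + 1))
    let s' : T.ringOver (n + 1) ⟶ T.ringOver (n + 2) := algMap s.hom hs'
    -- The product itself serves as the relative tensor product, so the step isomorphism is the
    -- identity.
    refine ⟨_, stepMap m s', Iso.refl _, h, ?_, ?_⟩
    · exact (congr((stepMap m s').hom ≫ $(Category.id_comp _))).trans (stepMap_fst m s')
    · exact (congr((ρ_ _).inv ≫ (_ ◁ η[(T.ringOver (n + 1)).X]) ≫ (stepMap m s').hom ≫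
        $(Category.id_comp _))).trans (stepMap_incl m s')

lemma isZero_mod_iff (M : Mod C A.X) : IsZero M ↔ IsZero M.X := by
  rw [IsZero.iff_id_eq_zero, IsZero.iff_id_eq_zero]
  exact ⟨fun h => congr(($h).hom), fun h => Mod.hom_ext _ _ h⟩

end degree

end TTRings

open TTRings
theorem theorem3p5 {K : Type u} [Category.{v} K] [EssentiallySmall.{w} K] [Preadditive K]
    [HasZeroObject K] [HasShift K ℤ] [∀ n : ℤ, (shiftFunctor K n).Additive] [Pretriangulated K]
    [MonoidalCategory K] [SymmetricCategory K] [TTCategory K]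
    (A : Mon K) [IsTTRing A.X] (d : ℕ) (hd : HasDegree A d) (T : SplittingTower A) :
    Nonempty ((extFunctor A.X).mapMon.obj A ≅
      prodRing (Mon.trivial (Mod K A.X)) T.secondOver) ∧
    IsTTRing T.secondOver.X ∧
    (1 ≤ d → HasDegree T.secondOver (d - 1)) := by
  refine ⟨⟨T.exists_ext_iso.choose⟩, isTTRing_algRing (T.ringOne.inv ≫ T.map 1).hom, fun h => ?_⟩
  -- With `d = n + 1`, positions `n` and `n + 1` of the shifted tower are positions `d` and `d + 1`
  -- of `T'`.
  obtain ⟨n, rfl⟩ := Nat.exists_eq_add_of_le' h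
  obtain ⟨T', h₁, h₂⟩ := hd
  obtain ⟨e⟩ := T'.nonempty_secondOver_iso T
  exact ⟨T'.shift e, fun hz => h₁ ((isZero_mod_iff _).1 hz), (isZero_mod_iff _).2 h₂⟩
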